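/- \textbf{Conventions.} All spaces are real. For $E=(\mathbb R^N,\|\cdot\|)$ let $B_E=\{x:\|x\|\le 1\}$, let $B_2^N$ and $B_1^N$ be the unit balls of the $\ell_2^N$- and $\ell_1^N$-norms, and define the volume ratio $\mathrm{vr}(E)=(\mathrm{vol}\,B_E/\mathrm{vol}\,\mathcal E_{\max})^{1/N}$, where $\mathcal E_{\max}$ is the (origin-centred) ellipsoid of maximal volume contained in $B_E$. For an integer $1\le k\le N$ let $$V_k(E)=\sup\Bigl\{\bigl(\mathrm{vol}\,P_G(B_E)/\mathrm{vol}\,P_G(B_2^N)\bigr)^{1/k} : G\subset\mathbb R^N \text{ a subspace},\ \dim G=k\Bigr\},$$ where $P_G$ is the orthogonal projection onto $G$; for real $t\in(0,N]$ put $V_t(E)=V_{\lceil t\rceil}(E)$. A quotient $F=E/K$ carries the quotient norm, and its natural Euclidean norm $|\cdot|_2$ is the one whose unit ball is the image of $B_2^N$ under $E\to F$. If $\dim F=n$, a linear operator $T:F\to F$ belongs to $\mathrm{Mix}_n(k,\beta)$, for real $k,\beta\ge 0$, if there is a subspace $G\subset F$ with $\dim G\ge k$ such that $|P_{G^\perp}Tx|_2\ge\beta|x|_2$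 for all $x\in G$, orthogonality being taken with respect to $|\cdot|_2$. \textbf{Theorem.} For all $0<\eta<3/8$, $0<\varepsilon<2^{-5}\eta$, $0<\kappa\le 1$ and $\rho\ge 1$ there is a constant $c=c(\varepsilon,\eta,\kappa,\rho)>0$ such that the following holds. Let $0<\delta<1$ and $\gamma=2^{-5}\delta\varepsilon\eta$, let $n\ge 1$ be an integer such that $N=(1+\varepsilon)n$ is an integer, and let $0<a\le 1$. Let $E=(\mathbb R^N,\|\cdot\|)$ be an $N$-dimensional normed space such that $$B_E\subset B_2^N,\qquad \mathrm{vr}(E)\le\rho,\qquad \kappa B_1^N\subset B_E,\qquad aB_2^N\subset B_E.$$ Then $E$ has an $n$-dimensional quotient $F$ such that for every linear operator $T:F\to F$ with $T\in\mathrm{Mix}_n(\eta n,1)$ and every quotient map $Q:F\to Q(F)$ with $\mathrm{rank}\,Q\ge(1-\gamma)n$ one has $$\|QT:F\to Q(F)\|\ \ge\ c\,V_{\eta n/4}(E)^{-1}a^{\delta}.$$ -/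

import Mathlib

open MeasureTheory
open scoped Pointwise

noncomputable section

/-- `S` is a (non-degenerate, origin-centred) ellipsoid in `ℝ^N`. -/
def IsEllipsoid {N : ℕ} (S : Set (EuclideanSpace ℝ (Fin N))) : Prop :=
  ∃ A : EuclideanSpace ℝ (Fin N) ≃ₗ[ℝ] EuclideanSpace ℝ (Fin N),
    S = A '' Metric.closedBall 0 1

/-- The volume ratio `(vol B / vol 𝓔_max)^{1/N}` of a convex body `B ⊆ ℝ^N`; the volume of the
maximal volume ellipsoid is the supremum of the volumes of the ellipsoids contained in `B`. -/
def volumeRatio {N : ℕ} (B : Set (EuclideanSpace ℝ (Fin N))) : ℝ :=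
  (volume.real B /
    sSup {v : ℝ | ∃ S : Set (EuclideanSpace ℝ (Fin N)),
      IsEllipsoid S ∧ S ⊆ B ∧ v = volume.real S}) ^ (1 / (N : ℝ))

/-- Lebesgue measure on a subspace `G` of `ℝ^N`, normalised so that the unit cube of an
orthonormal basis of `G` has measure one. -/
def lebesgueOn {N : ℕ} (G : Submodule ℝ (EuclideanSpace ℝ (Fin N))) : Measure G :=
  (stdOrthonormalBasis ℝ G).toBasis.addHaar

/-- The invariant `V_k(B)`: the supremum of `(vol P_G(B) / vol P_G(B_2^N))^{1/k}` over all
`k`-dimensional subspaces `G`, where `P_G` is the orthogonal projection onto `G`. -/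
def volumeNumber {N : ℕ} (k : ℕ) (B : Set (EuclideanSpace ℝ (Fin N))) : ℝ :=
  sSup {v : ℝ | ∃ G : Submodule ℝ (EuclideanSpace ℝ (Fin N)), Module.finrank ℝ G = k ∧
    v = ((lebesgueOn G).real (G.orthogonalProjectionOnto '' B) /
      (lebesgueOn G).real (G.orthogonalProjectionOnto '' Metric.closedBall 0 1)) ^ (1 / (k : ℝ))}

/-- The unit ball `B_1^N` of `ℓ_1^N`, the absolute convex hull of the standard basis. -/
def l1Ball (N : ℕ) : Set (EuclideanSpace ℝ (Fin N)) :=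
  {x | ∑ i, |x i| ≤ 1}

/-- The unit ball `B_E`, in the coordinates `e` which identify `E` with `ℝ^N`. -/
def coordBall {N : ℕ} {E : Type*} [NormedAddCommGroup E] [NormedSpace ℝ E]
    (e : E ≃ₗ[ℝ] EuclideanSpace ℝ (Fin N)) : Set (EuclideanSpace ℝ (Fin N)) :=
  e '' Metric.closedBall 0 1

/-- `T` is `(k, β)`-mixing on the Euclidean space `H`: there is a subspace `G` with `dim G ≥ k`
and `|P_{G^⊥} T x|₂ ≥ β |x|₂` for all `x ∈ G`. -/
def IsMixing {H : Type*} [NormedAddCommGroup H] [InnerProductSpace ℝ H] [FiniteDimensional ℝ H]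
    (k β : ℝ) (T : H →ₗ[ℝ] H) : Prop :=
  ∃ G : Submodule ℝ H, k ≤ (Module.finrank ℝ G : ℝ) ∧
    ∀ x ∈ G, β * ‖x‖ ≤ ‖Gᗮ.starProjection (T x)‖

/-- The natural Euclidean structure on the quotient `F = E ⧸ K`: the class of `x` is identified
with the orthogonal projection of (the coordinates of) `x` to `K^⊥`. The Euclidean unit ball
of `F` is then the image of `B_2^N` under the quotient map. -/
def quotientCoords {N : ℕ} {E : Type*} [NormedAddCommGroup E] [NormedSpace ℝ E]
    (e : E ≃ₗ[ℝ] EuclideanSpace ℝ (Fin N)) (K : Submodule ℝ E) :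
    (E ⧸ K) ≃ₗ[ℝ] ↥((K.map (e : E →ₗ[ℝ] EuclideanSpace ℝ (Fin N)))ᗮ) :=
  (Submodule.Quotient.equiv K (K.map (e : E →ₗ[ℝ] EuclideanSpace ℝ (Fin N))) e rfl).trans
    (Submodule.quotientEquivOfIsCompl _ _ (Submodule.isCompl_orthogonal _))

end

/-! The quotient is found among the images of ℝ^(n+m), m = εn, under `[I | X]`, where X ranges over
the operator norm ball `opBall n m`; a volume count shows that some X works for all T and L at once.

Suppose that T is mixing and small modulo a subspace L of dimension at most d ≤ δεηn/32. Since κeᵢ ∈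
B, every T[I|X]eᵢ lies in τ[I|X]B + L for a small τ. The first n relations produce S : ℝⁿ → ℝ^(n+m)
with Seᵢ ∈ τB and T = [I|X]S modulo L. Eliminating T from the last m gives [I|X]S Xⱼ ∈ τ[I|X]B + L
for each column Xⱼ: a condition on X involving only S and L.

For fixed S and L this condition is rare (`volume_badSet_le`). Let the columns vary by vectors of a
subspace G on which the first block of S is mixing. Mixing yields k directions orthogonal to G, to
the base points of the columns and to L, in which that block, restricted to suitable vectors of G,
still expands by at least 1/4. Projecting there removes X from [I|X], and each column is confined to
a set governed by a k-dimensional projection of B. Each useful column thus contributes a factor of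
order (τV)^k, V = V_k(B), up to exponential factors.

Then S and L are discretised. By the volume ratio, the operators S have a net of cardinality
(256ρ)^((n+m)n) relative to an ellipsoid in B (`exists_net_tuples`). Its error lies in τB on vectors
of norm at most 1, and it spoils mixing little because all but k axes of the ellipsoid are at most
2V (`exists_submodule_norm_le`). L is coded by a contraction from ℝ^d (`exists_net_opBall`); its net
must have accuracy of order a, so that aB_2 ⊂ B absorbs the error. This costs a^(-nd) and is the
origin of a^δ. A Hilbert–Schmidt estimate retains at least half of the columns with SXⱼ controlled;
the set J of these columns is part of the union bound. Finally `opBall n m` is exponentially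
comparable in volume to a product of m Euclidean balls (`ballVol_pow_le_volume_opBall`), and
`union_bound_lt_one` shows that the exceptional sets do not cover it. -/

/-! ### Packing and slicing for translation-invariant measures -/

/-- A maximal family of disjoint translates of `D` with centres in `K` is a net of `K`. -/
lemma exists_net_of_measure {W : Type*} [AddCommGroup W] [MeasurableSpace W] [MeasurableAdd W]
    (μ : Measure W) [μ.IsAddLeftInvariant] {K D C : Set W} (hD : MeasurableSet D)
    (hD0 : μ D ≠ 0) (hC : μ C ≠ ⊤) (hKC : ∀ x ∈ K, ∀ d ∈ D, x + d ∈ C) :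
    ∃ s : Finset W, (s : Set W) ⊆ K ∧ (s.card : ENNReal) * μ D ≤ μ C ∧
      ∀ x ∈ K, ∃ p ∈ s, ∃ d₁ ∈ D, ∃ d₂ ∈ D, x - p = d₁ - d₂ := by
  classical
  let T : W → Set W := fun p => (fun y => -p + y) ⁻¹' D
  have hTm : ∀ p, MeasurableSet (T p) := fun p => measurable_const_add (-p) hD
  have hTμ : ∀ p, μ (T p) = μ D := fun p => measure_preimage_add μ (-p) D
  let P : Finset W → Prop := fun s => (s : Set W) ⊆ K ∧ (s : Set W).PairwiseDisjoint T
  have hcard : ∀ s, P s → (s.card : ENNReal) * μ D ≤ μ C := by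
    intro s hs
    have h1 : μ (⋃ p ∈ s, T p) = ∑ p ∈ s, μ (T p) :=
      measure_biUnion_finset hs.2 (fun p _ => hTm p)
    have h2 : (⋃ p ∈ s, T p) ⊆ C := by
      intro y hy
      simp only [Set.mem_iUnion] at hy
      obtain ⟨p, hp, hy⟩ := hy
      have := hKC p (hs.1 hp) _ hy
      simpa using this
    have h3 := measure_mono (μ := μ) h2
    rw [h1] at h3
    simpa [hTμ] using h3
  let S : Set ℕ := {c | ∃ s, P s ∧ s.card = c}
  have hne : S.Nonempty := ⟨0, ∅, by simp [P], rfl⟩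
  have hbdd : BddAbove S := by
    -- When D has infinite measure, the packing inequality permits only the empty family; otherwise
    -- cardinalities are bounded by μ C / μ D.
    by_cases htop : μ D = ⊤
    · refine ⟨0, ?_⟩
      rintro c ⟨s, hs, rfl⟩
      have h := hcard s hs
      by_contra hc
      push Not at hc
      rw [htop, ENNReal.mul_top (by simpa using hc.ne')] at h
      exact hC (top_le_iff.1 h)
    · obtain ⟨k, hk⟩ := ENNReal.exists_nat_gt (ENNReal.div_lt_top hC hD0).ne
      refine ⟨k, ?_⟩
      rintro c ⟨s, hs, rfl⟩
      have h := (ENNReal.le_div_iff_mul_le (Or.inl hD0) (Or.inl htop)).2 (hcard s hs)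
      exact_mod_cast (h.trans hk.le)
  obtain ⟨s, hs, hsc⟩ := Nat.sSup_mem hne hbdd
  refine ⟨s, hs.1, hcard s hs, ?_⟩
  intro x hx
  obtain ⟨d, hd⟩ : D.Nonempty := nonempty_of_measure_ne_zero hD0
  by_cases hxs : x ∈ s
  · exact ⟨x, hxs, d, hd, d, hd, by simp⟩
  · by_contra hcon
    push Not at hcon
    have hP : P (insert x s) := by
      refine ⟨?_, ?_⟩
      · rw [Finset.coe_insert]
        exact Set.insert_subset hx hs.1
      · rw [Finset.coe_insert]
        refine hs.2.insert ?_
        intro p hp _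
        rw [Set.disjoint_left]
        intro y hy hy'
        refine hcon p hp _ hy' _ hy ?_
        change x - p = (-p + y) - (-x + y)
        abel
    have : (insert x s).card ≤ sSup S := le_csSup hbdd ⟨_, hP, rfl⟩
    rw [Finset.card_insert_of_notMem hxs] at this
    omega

/-- If all translated slices of `D` have measure at most `v`, then `D` is small. -/
lemma measure_mul_measure_le_of_slices {W U : Type*} [AddCommGroup W] [MeasurableSpace W]
    [MeasurableAdd₂ W] [MeasurableSpace U] (μ : Measure W) [SFinite μ]
    [μ.IsAddRightInvariant] (ν : Measure U) [SFinite ν] {φ : U → W} (hφ : Measurable φ)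
    {A : Set U} (hA : MeasurableSet A) {C D : Set W} (hD : MeasurableSet D)
    (hCm : MeasurableSet C)
    {v : ENNReal} (hC : ∀ w, ∀ u ∈ A, w + φ u ∈ D → w ∈ C)
    (hv : ∀ w ∈ C, ν {u | u ∈ A ∧ w + φ u ∈ D} ≤ v) :
    ν A * μ D ≤ v * μ C := by
  -- Fubini on pairs (w, u): sections at fixed u ∈ A are translates of D, while sections at fixed w
  -- are empty unless w ∈ C and have measure at most v there.
  let S : Set (W × U) := {z | z.2 ∈ A ∧ z.1 + φ z.2 ∈ D}
  have hS : MeasurableSet S := by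
    refine (measurable_snd hA).inter ?_
    exact (measurable_fst.add (hφ.comp measurable_snd)) hD
  have h1 : (μ.prod ν) S = ν A * μ D := by
    rw [Measure.prod_apply_symm hS]
    have : ∀ u, μ ((fun w => (w, u)) ⁻¹' S) = A.indicator (fun _ => μ D) u := by
      intro u
      by_cases hu : u ∈ A
      · rw [Set.indicator_of_mem hu]
        have : ((fun w => (w, u)) ⁻¹' S) = (fun w => w + φ u) ⁻¹' D := by
          ext w; simp [S, hu]
        rw [this, measure_preimage_add_right]
      · rw [Set.indicator_of_notMem hu]
        have : ((fun w => (w, u)) ⁻¹' S) = ∅ := by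
          ext w; simp [S, hu]
        rw [this, measure_empty]
    simp_rw [this]
    rw [lintegral_indicator hA, lintegral_const, Measure.restrict_apply MeasurableSet.univ,
      Set.univ_inter, mul_comm]
  have h2 : (μ.prod ν) S ≤ v * μ C := by
    rw [Measure.prod_apply hS]
    calc ∫⁻ w, ν (Prod.mk w ⁻¹' S) ∂μ ≤ ∫⁻ w, C.indicator (fun _ => v) w ∂μ := by
          refine lintegral_mono fun w => ?_
          by_cases hw : w ∈ C
          · rw [Set.indicator_of_mem hw]
            exact hv w hw
          · have : (Prod.mk w ⁻¹' S) = ∅ := by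
              ext u
              simp only [S, Set.mem_preimage, Set.mem_ofPred_eq, Set.mem_empty_iff_false, iff_false]
              exact fun h => hw (hC w u h.1 h.2)
            rw [this, measure_empty]
            exact zero_le
      _ = v * μ C := by
          rw [lintegral_indicator hCm, lintegral_const, Measure.restrict_apply MeasurableSet.univ,
            Set.univ_inter]
  exact h1 ▸ h2

/-! ### Tuples as operators, and elementary volumes -/

/-- The linear map with columns `X j`. -/
noncomputable def tupleMap {p q : ℕ} (X : Fin q → EuclideanSpace ℝ (Fin p)) :
    EuclideanSpace ℝ (Fin q) →ₗ[ℝ] EuclideanSpace ℝ (Fin p) where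
  toFun v := ∑ j, v j • X j
  map_add' v w := by simp [add_smul, Finset.sum_add_distrib]
  map_smul' r v := by simp [Finset.smul_sum, mul_smul]

lemma tupleMap_apply {p q : ℕ} (X : Fin q → EuclideanSpace ℝ (Fin p))
    (v : EuclideanSpace ℝ (Fin q)) : tupleMap X v = ∑ j, v j • X j := rfl

lemma tupleMap_single {p q : ℕ} (X : Fin q → EuclideanSpace ℝ (Fin p)) (j : Fin q) :
    tupleMap X (EuclideanSpace.single j 1) = X j := by
  rw [tupleMap_apply, Finset.sum_eq_single j] <;> simp +contextual

lemma tupleMap_add {p q : ℕ} (X Y : Fin q → EuclideanSpace ℝ (Fin p))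
    (v : EuclideanSpace ℝ (Fin q)) : tupleMap (X + Y) v = tupleMap X v + tupleMap Y v := by
  simp [tupleMap_apply, Finset.sum_add_distrib]

lemma tupleMap_sub {p q : ℕ} (X Y : Fin q → EuclideanSpace ℝ (Fin p))
    (v : EuclideanSpace ℝ (Fin q)) : tupleMap (X - Y) v = tupleMap X v - tupleMap Y v := by
  simp [tupleMap_apply, smul_sub, Finset.sum_sub_distrib]

lemma tupleMap_smul {p q : ℕ} (r : ℝ) (X : Fin q → EuclideanSpace ℝ (Fin p))
    (v : EuclideanSpace ℝ (Fin q)) : tupleMap (r • X) v = r • tupleMap X v := by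
  simp only [tupleMap_apply, Finset.smul_sum, Pi.smul_apply]
  exact Finset.sum_congr rfl fun _ _ => smul_comm _ _ _

lemma tupleMap_comp {p q r : ℕ} (X : Fin q → EuclideanSpace ℝ (Fin p))
    (A : EuclideanSpace ℝ (Fin p) →ₗ[ℝ] EuclideanSpace ℝ (Fin r))
    (v : EuclideanSpace ℝ (Fin q)) : tupleMap (fun j => A (X j)) v = A (tupleMap X v) := by
  simp [tupleMap_apply]

/-- The tuples whose associated operator between Euclidean spaces has norm at most one. -/
def opBall (p q : ℕ) : Set (Fin q → EuclideanSpace ℝ (Fin p)) :=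
  {X | ∀ v, ‖tupleMap X v‖ ≤ ‖v‖}

lemma continuous_tupleMap {p q : ℕ} (v : EuclideanSpace ℝ (Fin q)) :
    Continuous fun X : Fin q → EuclideanSpace ℝ (Fin p) => tupleMap X v := by
  simp only [tupleMap_apply]
  fun_prop

lemma isClosed_opBall (p q : ℕ) : IsClosed (opBall p q) := by
  have : opBall p q = ⋂ v, {X | ‖tupleMap X v‖ ≤ ‖v‖} := by
    ext X; simp [opBall]
  rw [this]
  exact isClosed_iInter fun v => isClosed_le (continuous_tupleMap v).norm continuous_const

lemma opBall_sub_mem {p q : ℕ} {X Y : Fin q → EuclideanSpace ℝ (Fin p)} (hX : X ∈ opBall p q)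
    (hY : Y ∈ opBall p q) (v : EuclideanSpace ℝ (Fin q)) :
    ‖tupleMap (X - Y) v‖ ≤ 2 * ‖v‖ := by
  rw [tupleMap_sub]
  linarith [norm_sub_le (tupleMap X v) (tupleMap Y v), hX v, hY v]

lemma norm_le_one_of_mem_opBall {p q : ℕ} {X : Fin q → EuclideanSpace ℝ (Fin p)}
    (hX : X ∈ opBall p q) (j : Fin q) : ‖X j‖ ≤ 1 := by
  have := hX (EuclideanSpace.single j 1)
  rwa [tupleMap_single, PiLp.norm_single, norm_one] at this

/-- The transpose of a contraction is a contraction. -/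
lemma sum_inner_sq_le_of_mem_opBall {p q : ℕ} {X : Fin q → EuclideanSpace ℝ (Fin p)}
    (hX : X ∈ opBall p q) (w : EuclideanSpace ℝ (Fin p)) :
    ∑ j, (inner ℝ (X j) w) ^ 2 ≤ ‖w‖ ^ 2 := by
  set v : EuclideanSpace ℝ (Fin q) := WithLp.toLp 2 fun j => inner ℝ (X j) w with hv
  have h1 : ‖v‖ ^ 2 = ∑ j, (inner ℝ (X j) w) ^ 2 := by
    rw [EuclideanSpace.norm_sq_eq]; simp [hv]
  have h2 : ‖v‖ ^ 2 = inner ℝ (tupleMap X v) w := by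
    rw [h1, tupleMap_apply, sum_inner]
    refine Finset.sum_congr rfl fun j _ => ?_
    rw [real_inner_smul_left, sq, hv]
  have h3 : ‖v‖ ^ 2 ≤ ‖v‖ * ‖w‖ := by
    rw [h2]
    exact (real_inner_le_norm _ _).trans (mul_le_mul_of_nonneg_right (hX v) (norm_nonneg _))
  rw [← h1]
  have h4 : ‖v‖ ≤ ‖w‖ := by
    by_contra h
    push Not at h
    nlinarith [norm_nonneg w, norm_nonneg v]
  exact pow_le_pow_left₀ (norm_nonneg _) h4 2

lemma volume_pi_set {p q : ℕ} (s : Fin q → Set (EuclideanSpace ℝ (Fin p))) :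
    volume (Set.univ.pi s) = ∏ j, volume (s j) := by
  rw [volume_pi, Measure.pi_pi]

/-- Volume of the unit ball. -/
noncomputable def ballVol (p : ℕ) : ENNReal :=
  volume (Metric.closedBall (0 : EuclideanSpace ℝ (Fin p)) 1)

lemma ballVol_ne_top (p : ℕ) : ballVol p ≠ ⊤ :=
  (isCompact_closedBall (0 : EuclideanSpace ℝ (Fin p)) 1).measure_lt_top.ne

lemma ballVol_ne_zero (p : ℕ) : ballVol p ≠ 0 :=
  (Metric.measure_closedBall_pos volume (0 : EuclideanSpace ℝ (Fin p)) one_pos).ne'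

lemma volume_closedBall_zero {p : ℕ} {r : ℝ} (hr : 0 ≤ r) :
    volume (Metric.closedBall (0 : EuclideanSpace ℝ (Fin p)) r) =
      ENNReal.ofReal r ^ p * ballVol p := by
  have := Measure.addHaar_closedBall' (volume : Measure (EuclideanSpace ℝ (Fin p))) 0 hr
  rw [this, finrank_euclideanSpace_fin, ENNReal.ofReal_pow hr, ballVol]

lemma volume_smul_set {p : ℕ} {r : ℝ} (hr : 0 ≤ r) (s : Set (EuclideanSpace ℝ (Fin p))) :
    volume (r • s) = ENNReal.ofReal r ^ p * volume s := by
  rw [Measure.addHaar_smul, finrank_euclideanSpace_fin, abs_of_nonneg (by positivity),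
    ENNReal.ofReal_pow hr]

lemma volume_smul_tuple {p q : ℕ} {r : ℝ} (hr : 0 ≤ r)
    (s : Set (Fin q → EuclideanSpace ℝ (Fin p))) :
    volume (r • s) = ENNReal.ofReal r ^ (p * q) * volume s := by
  rw [Measure.addHaar_smul, Module.finrank_pi_fintype]
  simp only [finrank_euclideanSpace_fin, Finset.sum_const, Finset.card_univ, Fintype.card_fin,
    smul_eq_mul]
  rw [abs_of_nonneg (by positivity), ENNReal.ofReal_pow hr, mul_comm p q]

/-- A linear map which expands by `β⁻¹` shrinks volumes of preimages. -/
lemma volume_preimage_le_of_expanding {k : ℕ} {β : ℝ} (hβ : 0 < β)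
    (M : EuclideanSpace ℝ (Fin k) →ₗ[ℝ] EuclideanSpace ℝ (Fin k))
    (hM : ∀ u, ‖u‖ ≤ β * ‖M u‖) (s : Set (EuclideanSpace ℝ (Fin k))) :
    volume (M ⁻¹' s) ≤ ENNReal.ofReal β ^ k * volume s := by
  have hinj : Function.Injective M := by
    rw [← LinearMap.ker_eq_bot, LinearMap.ker_eq_bot']
    intro u hu
    have := hM u
    rw [hu, norm_zero, mul_zero] at this
    exact norm_le_zero_iff.1 this
  have hdet : LinearMap.det M ≠ 0 := by
    have : IsUnit M := (LinearMap.isUnit_iff_ker_eq_bot M).2 (LinearMap.ker_eq_bot.2 hinj)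
    exact (this.map (LinearMap.det : _ →* ℝ)).ne_zero
  have hpre := Measure.addHaar_preimage_linearMap
    (volume : Measure (EuclideanSpace ℝ (Fin k))) hdet
  -- The determinant is bounded by testing on the unit ball, whose preimage lies in the ball of
  -- radius β.
  have hle : ENNReal.ofReal |(LinearMap.det M)⁻¹| ≤ ENNReal.ofReal β ^ k := by
    have h1 : volume (M ⁻¹' Metric.closedBall 0 1) ≤
        volume (Metric.closedBall (0 : EuclideanSpace ℝ (Fin k)) β) := by
      refine measure_mono fun u hu => ?_
      rw [Set.mem_preimage, mem_closedBall_zero_iff] at hu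
      rw [mem_closedBall_zero_iff]
      exact (hM u).trans (mul_le_of_le_one_right hβ.le hu)
    rw [hpre, volume_closedBall_zero hβ.le] at h1
    exact (ENNReal.mul_le_mul_iff_left (ballVol_ne_zero k) (ballVol_ne_top k)).1 h1
  rw [hpre]
  gcongr

/-! ### Gaussian lower bound for the volume of the operator norm ball -/

/-- The Gaussian weight on tuples of vectors. -/
noncomputable def gaussWeight {p q : ℕ} (X : Fin q → EuclideanSpace ℝ (Fin p)) : ENNReal :=
  ENNReal.ofReal (Real.exp (-(∑ j, ‖X j‖ ^ 2) / 2))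

lemma lintegral_gaussWeight_ne_top (p q : ℕ) :
    ∫⁻ X : Fin q → EuclideanSpace ℝ (Fin p), gaussWeight X ≠ ⊤ := by
  have h1 : Integrable (fun x : EuclideanSpace ℝ (Fin p) => Real.exp (-‖x‖ ^ 2 / 2)) := by
    have h := (GaussianFourier.integrable_cexp_neg_mul_sq_norm_add (b := 1 / 2)
      (V := EuclideanSpace ℝ (Fin p)) (by norm_num) 0 0).norm
    refine h.congr (Filter.Eventually.of_forall fun x => ?_)
    simp only [Complex.norm_exp]
    congr 1
    have : (-(1 / 2 : ℂ) * (‖x‖ : ℂ) ^ 2 + 0 * ((inner ℝ (0 : EuclideanSpace ℝ (Fin p)) x : ℝ) : ℂ))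
      = ((-‖x‖ ^ 2 / 2 : ℝ) : ℂ) := by push_cast; ring
    rw [this, Complex.ofReal_re]
  have h2 : Integrable (fun X : Fin q → EuclideanSpace ℝ (Fin p) =>
      ∏ j, Real.exp (-‖X j‖ ^ 2 / 2)) := Integrable.fintype_prod (fun _ => h1)
  have h3 : (fun X : Fin q → EuclideanSpace ℝ (Fin p) => gaussWeight X) =
      fun X => ENNReal.ofReal (∏ j, Real.exp (-‖X j‖ ^ 2 / 2)) := by
    funext X
    rw [gaussWeight, ← Real.exp_sum, ← Finset.sum_div, Finset.sum_neg_distrib]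
  rw [h3]
  exact h2.lintegral_lt_top.ne

/-- Completing the square: on the half-space the weight at X is at most exp(-s²/2) times the weight
at X - sY, and translation preserves the total integral. No marginal distribution is needed. -/
lemma setLIntegral_gaussWeight_le {p q : ℕ} {s : ℝ} (hs : 0 ≤ s)
    (Y : Fin q → EuclideanSpace ℝ (Fin p)) (hY : ∑ j, ‖Y j‖ ^ 2 ≤ 1) :
    ∫⁻ X in {X : Fin q → EuclideanSpace ℝ (Fin p) | s ≤ ∑ j, inner ℝ (X j) (Y j)},
      gaussWeight X ≤
    ENNReal.ofReal (Real.exp (-s ^ 2 / 2)) *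
      ∫⁻ X : Fin q → EuclideanSpace ℝ (Fin p), gaussWeight X := by
  have hmeas : MeasurableSet
      {X : Fin q → EuclideanSpace ℝ (Fin p) | s ≤ ∑ j, inner ℝ (X j) (Y j)} :=
    (isClosed_le continuous_const (by fun_prop)).measurableSet
  calc _ ≤ ∫⁻ X in {X : Fin q → EuclideanSpace ℝ (Fin p) | s ≤ ∑ j, inner ℝ (X j) (Y j)},
        ENNReal.ofReal (Real.exp (-s ^ 2 / 2)) * gaussWeight (X - s • Y) := by
        refine setLIntegral_mono' hmeas fun X hX => ?_
        rw [gaussWeight, gaussWeight, ← ENNReal.ofReal_mul (Real.exp_nonneg _), ← Real.exp_add]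
        refine ENNReal.ofReal_le_ofReal (Real.exp_le_exp.2 ?_)
        have hX' : s ≤ ∑ j, inner ℝ (X j) (Y j) := hX
        have : ∑ j, ‖(X - s • Y) j‖ ^ 2 =
            ∑ j, ‖X j‖ ^ 2 - 2 * s * ∑ j, inner ℝ (X j) (Y j) + s ^ 2 * ∑ j, ‖Y j‖ ^ 2 := by
          rw [Finset.mul_sum, Finset.mul_sum, ← Finset.sum_sub_distrib, ← Finset.sum_add_distrib]
          refine Finset.sum_congr rfl fun j _ => ?_
          rw [Pi.sub_apply, Pi.smul_apply, norm_sub_sq_real, norm_smul, real_inner_smul_right,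
            mul_pow, Real.norm_eq_abs, sq_abs]
          ring
        rw [this]
        nlinarith [mul_le_mul_of_nonneg_left hX' hs, mul_le_mul_of_nonneg_left hY (sq_nonneg s)]
    _ ≤ ∫⁻ X : Fin q → EuclideanSpace ℝ (Fin p),
        ENNReal.ofReal (Real.exp (-s ^ 2 / 2)) * gaussWeight (X - s • Y) :=
        setLIntegral_le_lintegral _ _
    _ = _ := by
        rw [lintegral_const_mul' _ _ ENNReal.ofReal_ne_top,
          lintegral_sub_right_eq_self (fun X : Fin q → EuclideanSpace ℝ (Fin p) => gaussWeight X)]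

lemma exists_quarter_net (p : ℕ) : ∃ s : Finset (EuclideanSpace ℝ (Fin p)),
    (∀ u ∈ s, ‖u‖ ≤ 1) ∧ s.card ≤ 9 ^ p ∧
      ∀ x : EuclideanSpace ℝ (Fin p), ‖x‖ ≤ 1 → ∃ u ∈ s, ‖x - u‖ ≤ 1 / 4 := by
  have hv0 := ballVol_ne_zero p
  have hvt := ballVol_ne_top p
  have hD := volume_closedBall_zero (p := p) (r := 1 / 8) (by norm_num)
  have hC := volume_closedBall_zero (p := p) (r := 9 / 8) (by norm_num)
  obtain ⟨s, hsK, hcard, hnet⟩ := exists_net_of_measure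
    (volume : Measure (EuclideanSpace ℝ (Fin p))) (K := Metric.closedBall 0 1)
    (D := Metric.closedBall 0 (1 / 8)) (C := Metric.closedBall 0 (9 / 8))
    Metric.isClosed_closedBall.measurableSet
    (Metric.measure_closedBall_pos volume _ (by norm_num)).ne'
    (isCompact_closedBall _ _).measure_lt_top.ne
    (by
      intro x hx d hd
      rw [mem_closedBall_zero_iff] at *
      linarith [norm_add_le x d])
  refine ⟨s, fun u hu => mem_closedBall_zero_iff.1 (hsK hu), ?_, ?_⟩
  · rw [hD, hC, ← mul_assoc, ENNReal.mul_le_mul_iff_left hv0 hvt] at hcard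
    have h9 : ENNReal.ofReal (9 / 8) = 9 * ENNReal.ofReal (1 / 8) := by
      rw [show (9 / 8 : ℝ) = 9 * (1 / 8) by norm_num, ENNReal.ofReal_mul (by norm_num)]
      norm_num
    rw [h9, mul_pow, ENNReal.mul_le_mul_iff_left (pow_ne_zero _ (by simp))
      (ENNReal.pow_ne_top ENNReal.ofReal_ne_top)] at hcard
    exact_mod_cast hcard
  · intro x hx
    obtain ⟨u, hu, d₁, h₁, d₂, h₂, h⟩ := hnet x (mem_closedBall_zero_iff.2 hx)
    refine ⟨u, hu, ?_⟩
    rw [mem_closedBall_zero_iff] at h₁ h₂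
    rw [h]
    linarith [norm_sub_le d₁ d₂]

/-- Replacing each of the two arguments of the bilinear form by a net point costs ‖T‖/4, so ‖T‖ ≤ s
+ ‖T‖/2. -/
lemma norm_le_of_inner_net {p q : ℕ} {s : ℝ}
    {Nq : Finset (EuclideanSpace ℝ (Fin q))} {Np : Finset (EuclideanSpace ℝ (Fin p))}
    (hNq1 : ∀ u ∈ Nq, ‖u‖ ≤ 1)
    (hNq : ∀ x : EuclideanSpace ℝ (Fin q), ‖x‖ ≤ 1 → ∃ u ∈ Nq, ‖x - u‖ ≤ 1 / 4)
    (hNp : ∀ x : EuclideanSpace ℝ (Fin p), ‖x‖ ≤ 1 → ∃ u ∈ Np, ‖x - u‖ ≤ 1 / 4)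
    (T : EuclideanSpace ℝ (Fin q) →L[ℝ] EuclideanSpace ℝ (Fin p))
    (hT : ∀ u ∈ Nq, ∀ v ∈ Np, inner ℝ (T u) v ≤ s) : ‖T‖ ≤ 2 * s := by
  have hs : ∀ x, ‖x‖ ≤ 1 → ∀ y, ‖y‖ ≤ 1 → inner ℝ (T x) y ≤ s + ‖T‖ / 2 := by
    intro x hx y hy
    obtain ⟨u, hu, hxu⟩ := hNq x hx
    obtain ⟨v, hv, hyv⟩ := hNp y hy
    have h1 : inner ℝ (T x) y =
        inner ℝ (T u) v + inner ℝ (T (x - u)) y + inner ℝ (T u) (y - v) := by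
      rw [map_sub, inner_sub_left, inner_sub_right]; ring
    have hn := norm_nonneg T
    have h2 : inner ℝ (T (x - u)) y ≤ ‖T‖ / 4 :=
      calc inner ℝ (T (x - u)) y ≤ ‖T (x - u)‖ * ‖y‖ := real_inner_le_norm _ _
        _ ≤ (‖T‖ * (1 / 4)) * 1 := by
          gcongr
          exact (T.le_opNorm _).trans (by gcongr)
        _ = ‖T‖ / 4 := by ring
    have h3 : inner ℝ (T u) (y - v) ≤ ‖T‖ / 4 :=
      calc inner ℝ (T u) (y - v) ≤ ‖T u‖ * ‖y - v‖ := real_inner_le_norm _ _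
        _ ≤ (‖T‖ * 1) * (1 / 4) := by
          gcongr
          exact (T.le_opNorm _).trans (by gcongr; exact hNq1 u hu)
        _ = ‖T‖ / 4 := by ring
    linarith [hT u hu v hv]
  have h0 := hs 0 (by simp) 0 (by simp)
  rw [map_zero, inner_zero_left] at h0
  have hn : ‖T‖ ≤ s + ‖T‖ / 2 := by
    refine ContinuousLinearMap.opNorm_le_of_unit_norm h0 fun x hx => ?_
    by_cases hTx : T x = 0
    · rw [hTx, norm_zero]; exact h0
    · have := hs x hx.le (‖T x‖⁻¹ • T x) (by
        rw [norm_smul, norm_inv, norm_norm, inv_mul_cancel₀ (norm_ne_zero_iff.2 hTx)])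
      rwa [real_inner_smul_right, real_inner_self_eq_norm_sq, sq, ← mul_assoc,
        inv_mul_cancel₀ (norm_ne_zero_iff.2 hTx), one_mul] at this
  linarith

/-- The operator norm unit ball has the volume of a product of Euclidean balls, up to the
exponential factor `32 ^ (p * q)`. -/
lemma ballVol_pow_le_volume_opBall {p q : ℕ} (hq : 0 < q) (hqp : q ≤ p) :
    ballVol p ^ q ≤ 32 ^ (p * q) * volume (opBall p q) := by
  obtain ⟨Nq, hNq1, hNqc, hNq⟩ := exists_quarter_net q
  obtain ⟨Np, hNp1, hNpc, hNp⟩ := exists_quarter_net p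
  have hp : 0 < p := hq.trans_le hqp
  -- With this s the tail is exp(-8p), which beats the at most 81^p pairs of net points and leaves
  -- at least half of the Gaussian mass.
  set s : ℝ := 4 * √p with hs
  have hp1 : (1 : ℝ) ≤ p := by exact_mod_cast hp
  have hsp : (1 : ℝ) ≤ √p := by rw [Real.one_le_sqrt]; exact hp1
  set I := ∫⁻ X : Fin q → EuclideanSpace ℝ (Fin p), gaussWeight X with hI
  have hItop : I ≠ ⊤ := lintegral_gaussWeight_ne_top p q
  let bad : EuclideanSpace ℝ (Fin q) → EuclideanSpace ℝ (Fin p) →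
    Set (Fin q → EuclideanSpace ℝ (Fin p)) := fun u v => {X | s ≤ inner ℝ (tupleMap X u) v}
  set K := (⋃ z ∈ Nq ×ˢ Np, bad z.1 z.2)ᶜ with hK
  have hbadm : ∀ u v, MeasurableSet (bad u v) := fun u v =>
    (isClosed_le continuous_const ((continuous_tupleMap u).inner continuous_const)).measurableSet
  have hKm : MeasurableSet K := (Finset.measurableSet_biUnion _ fun z _ => hbadm _ _).compl
  have hbad : ∀ z ∈ Nq ×ˢ Np, ∫⁻ X in bad z.1 z.2, gaussWeight X ≤
      ENNReal.ofReal (Real.exp (-s ^ 2 / 2)) * I := by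
    intro z hz
    rw [Finset.mem_product] at hz
    have hset : bad z.1 z.2 = {X | s ≤ ∑ j, inner ℝ (X j) (z.1 j • z.2)} := by
      ext X
      simp [bad, tupleMap_apply, sum_inner, real_inner_smul_left, real_inner_smul_right]
    rw [hset]
    refine setLIntegral_gaussWeight_le (by positivity) _ ?_
    simp only [norm_smul, mul_pow]
    rw [← Finset.sum_mul, ← EuclideanSpace.norm_sq_eq]
    exact mul_le_one₀ (pow_le_one₀ (norm_nonneg _) (hNq1 _ hz.1)) (by positivity)
      (pow_le_one₀ (norm_nonneg _) (hNp1 _ hz.2))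
  have hcompl : ∫⁻ X in Kᶜ, gaussWeight X ≤ I / 2 := by
    rw [hK, compl_compl]
    have hc : ((Nq ×ˢ Np).card : ENNReal) * ENNReal.ofReal (Real.exp (-s ^ 2 / 2)) ≤ 1 / 2 := by
      have hcard : ((Nq ×ˢ Np).card : ℝ) ≤ 81 ^ p := by
        rw [Finset.card_product]
        push_cast
        calc (Nq.card : ℝ) * Np.card ≤ 9 ^ q * 9 ^ p := by
              gcongr
              · exact_mod_cast hNqc
              · exact_mod_cast hNpc
          _ ≤ 9 ^ p * 9 ^ p := by gcongr; norm_num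
          _ = 81 ^ p := by rw [← mul_pow]; norm_num
      have hexp : Real.exp (-s ^ 2 / 2) ≤ (1 / 162) ^ p := by
        have : -s ^ 2 / 2 = (p : ℝ) * (-8) := by
          rw [hs, mul_pow, Real.sq_sqrt (by positivity)]; ring
        rw [this, Real.exp_nat_mul]
        gcongr
        rw [Real.exp_neg, one_div]
        gcongr
        have h2 : (2.7 : ℝ) ≤ Real.exp 1 := by linarith [Real.exp_one_gt_d9]
        have : Real.exp 8 = Real.exp 1 ^ 8 := by rw [← Real.exp_nat_mul]; norm_num
        rw [this]
        calc (162 : ℝ) ≤ 2.7 ^ 8 := by norm_num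
          _ ≤ Real.exp 1 ^ 8 := by gcongr
      have hfin : ((Nq ×ˢ Np).card : ℝ) * Real.exp (-s ^ 2 / 2) ≤ 1 / 2 :=
        calc _ ≤ (81 : ℝ) ^ p * (1 / 162) ^ p := by gcongr
          _ = (1 / 2) ^ p := by rw [← mul_pow]; norm_num
          _ ≤ 1 / 2 := pow_le_of_le_one (by norm_num) (by norm_num) hp.ne'
      have := ENNReal.ofReal_le_ofReal hfin
      rw [ENNReal.ofReal_mul (by positivity), ENNReal.ofReal_natCast] at this
      refine this.trans (le_of_eq ?_)
      rw [ENNReal.ofReal_div_of_pos (by norm_num)]; norm_num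
    calc ∫⁻ X in ⋃ z ∈ Nq ×ˢ Np, bad z.1 z.2, gaussWeight X
        ≤ ∑ z ∈ Nq ×ˢ Np, ∫⁻ X in bad z.1 z.2, gaussWeight X := by
          simp only [← withDensity_apply' gaussWeight]
          exact measure_biUnion_finset_le _ _
      _ ≤ ∑ z ∈ Nq ×ˢ Np, ENNReal.ofReal (Real.exp (-s ^ 2 / 2)) * I := Finset.sum_le_sum hbad
      _ = ((Nq ×ˢ Np).card * ENNReal.ofReal (Real.exp (-s ^ 2 / 2))) * I := by
          rw [Finset.sum_const, nsmul_eq_mul, mul_assoc]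
      _ ≤ 1 / 2 * I := by gcongr
      _ = I / 2 := by rw [one_div, mul_comm, ENNReal.div_eq_inv_mul, mul_comm]
  -- The weight is at most 1, so Gaussian mass is bounded by Lebesgue volume.
  have hKI : I ≤ 2 * volume K := by
    have h1 : I = (∫⁻ X in K, gaussWeight X) + ∫⁻ X in Kᶜ, gaussWeight X :=
      (lintegral_add_compl _ hKm).symm
    have h2 : ∫⁻ X in K, gaussWeight X ≤ volume K := by
      calc ∫⁻ X in K, gaussWeight X ≤ ∫⁻ X in K, 1 := by
            refine lintegral_mono fun X => ?_
            rw [gaussWeight, ← ENNReal.ofReal_one]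
            refine ENNReal.ofReal_le_ofReal (Real.exp_le_one_iff.2 ?_)
            have : 0 ≤ ∑ j, ‖X j‖ ^ 2 := by positivity
            linarith
        _ = volume K := by rw [setLIntegral_one]
    have h3 : I ≤ volume K + I / 2 := by
      calc I = (∫⁻ X in K, gaussWeight X) + ∫⁻ X in Kᶜ, gaussWeight X := h1
        _ ≤ _ := add_le_add h2 hcompl
    have h4 : I / 2 + I / 2 ≤ volume K + I / 2 := by rwa [ENNReal.add_halves]
    have h5 : I / 2 ≤ volume K :=
      (ENNReal.add_le_add_iff_right (ENNReal.div_ne_top hItop (by norm_num))).1 h4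
    rw [ENNReal.div_le_iff (by norm_num) (by norm_num)] at h5
    rwa [mul_comm]
  have hKop : K ⊆ (2 * s) • opBall p q := by
    intro X hX
    have h2s : 0 < 2 * s := by positivity
    refine ⟨(2 * s)⁻¹ • X, fun v => ?_, smul_inv_smul₀ h2s.ne' X⟩
    have hT := norm_le_of_inner_net (s := s) hNq1 hNq hNp
      (LinearMap.toContinuousLinearMap (tupleMap X)) (by
        intro u hu v hv
        by_contra hcon
        push Not at hcon
        refine hX ?_
        simp only [Set.mem_iUnion]
        exact ⟨(u, v), Finset.mk_mem_product hu hv, hcon.le⟩)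
    have := (LinearMap.toContinuousLinearMap (tupleMap X)).le_of_opNorm_le hT v
    rw [tupleMap_smul, norm_smul, norm_inv, Real.norm_of_nonneg h2s.le,
      inv_mul_le_iff₀ h2s]
    exact this
  -- Restricting to the product of balls of radius √p, where the exponent is at least -pq/2, makes
  -- the powers of √p cancel against the scaling of `opBall p q`.
  have hIlow : ENNReal.ofReal (Real.exp (-(p * q) / 2)) *
      (ENNReal.ofReal √p ^ (p * q) * ballVol p ^ q) ≤ I := by
    have hvol : volume (Set.univ.pi fun _ : Fin q =>
        Metric.closedBall (0 : EuclideanSpace ℝ (Fin p)) √p) =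
        ENNReal.ofReal √p ^ (p * q) * ballVol p ^ q := by
      rw [volume_pi_set]
      simp only [volume_closedBall_zero (Real.sqrt_nonneg _), Finset.prod_const,
        Finset.card_univ, Fintype.card_fin, mul_pow, pow_mul]
    rw [← hvol, ← setLIntegral_const]
    refine (setLIntegral_mono' (MeasurableSet.univ_pi fun _ =>
      Metric.isClosed_closedBall.measurableSet) fun X hX => ?_).trans
      (setLIntegral_le_lintegral _ _)
    rw [gaussWeight]
    refine ENNReal.ofReal_le_ofReal (Real.exp_le_exp.2 ?_)
    have : ∑ j, ‖X j‖ ^ 2 ≤ ∑ _j : Fin q, (p : ℝ) := by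
      refine Finset.sum_le_sum fun j _ => ?_
      have h1 := mem_closedBall_zero_iff.1 (hX j (Set.mem_univ j))
      have h2 := pow_le_pow_left₀ (norm_nonneg _) h1 2
      rwa [Real.sq_sqrt (by positivity)] at h2
    rw [Finset.sum_const, Finset.card_univ, Fintype.card_fin, nsmul_eq_mul] at this
    linarith
  have hup : I ≤ 2 * (8 ^ (p * q) * ENNReal.ofReal √p ^ (p * q) * volume (opBall p q)) := by
    refine hKI.trans ?_
    gcongr
    refine (measure_mono hKop).trans (le_of_eq ?_)
    rw [volume_smul_tuple (by positivity), hs, ← mul_assoc,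
      ENNReal.ofReal_mul (by norm_num), mul_pow]
    norm_num
  have hexp : ((2 : ENNReal) ^ (p * q))⁻¹ ≤ ENNReal.ofReal (Real.exp (-(p * q) / 2)) := by
    have h1 : ((1 / 2 : ℝ)) ^ (p * q) ≤ Real.exp (-(p * q) / 2) := by
      have : -((p : ℝ) * q) / 2 = ((p * q : ℕ) : ℝ) * (-(1 / 2)) := by push_cast; ring
      rw [this, Real.exp_nat_mul]
      gcongr
      have := Real.add_one_le_exp (-(1 / 2) : ℝ)
      linarith
    refine le_trans (le_of_eq ?_) (ENNReal.ofReal_le_ofReal h1)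
    rw [ENNReal.ofReal_pow (by norm_num), ENNReal.ofReal_div_of_pos (by norm_num),
      ENNReal.ofReal_one, one_div, ENNReal.inv_pow]
    norm_num
  have hR0 : ENNReal.ofReal √p ^ (p * q) ≠ 0 :=
    pow_ne_zero _ (ENNReal.ofReal_pos.2 (by positivity)).ne'
  have hRt : ENNReal.ofReal √p ^ (p * q) ≠ ⊤ := ENNReal.pow_ne_top ENNReal.ofReal_ne_top
  have hall : ((2 : ENNReal) ^ (p * q))⁻¹ * (ENNReal.ofReal √p ^ (p * q) * ballVol p ^ q) ≤
      2 * (8 ^ (p * q) * ENNReal.ofReal √p ^ (p * q) * volume (opBall p q)) :=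
    (mul_le_mul_left hexp _).trans (hIlow.trans hup)
  rw [ENNReal.inv_mul_le_iff (pow_ne_zero _ (by norm_num))
    (ENNReal.pow_ne_top (by norm_num))] at hall
  have hall' : ENNReal.ofReal √p ^ (p * q) * ballVol p ^ q ≤
      ENNReal.ofReal √p ^ (p * q) * (32 ^ (p * q) * volume (opBall p q)) := by
    refine hall.trans ?_
    have hpq : p * q ≠ 0 := (Nat.mul_pos hp hq).ne'
    -- The base 32 is 2 · 2 · 8: one 2 bounds the Gaussian density loss √e, one absorbs the factor
    -- for half the mass, and 8 comes from the norm bound 8√p.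
    calc (2 : ENNReal) ^ (p * q) * (2 * (8 ^ (p * q) * ENNReal.ofReal √p ^ (p * q) *
          volume (opBall p q)))
        ≤ 2 ^ (p * q) * (2 ^ (p * q) * (8 ^ (p * q) * ENNReal.ofReal √p ^ (p * q) *
          volume (opBall p q))) := by
          gcongr
          exact le_self_pow (by norm_num) hpq
      _ = ENNReal.ofReal √p ^ (p * q) * ((2 * 2 * 8) ^ (p * q) * volume (opBall p q)) := by
          rw [mul_pow, mul_pow]; ring
      _ = _ := by norm_num
  exact (ENNReal.mul_le_mul_iff_right hR0 hRt).1 hall'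

/-! ### Projections, volume numbers and axes of ellipsoids -/

lemma adjoint_linearIsometry_apply {k N : ℕ}
    (φ : EuclideanSpace ℝ (Fin k) →ₗᵢ[ℝ] EuclideanSpace ℝ (Fin N))
    (u : EuclideanSpace ℝ (Fin k)) :
    LinearMap.adjoint φ.toLinearMap (φ u) = u := by
  refine ext_inner_right ℝ fun v => ?_
  rw [LinearMap.adjoint_inner_left]
  exact φ.inner_map_map u v

lemma norm_adjoint_linearIsometry_le {k N : ℕ}
    (φ : EuclideanSpace ℝ (Fin k) →ₗᵢ[ℝ] EuclideanSpace ℝ (Fin N))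
    (z : EuclideanSpace ℝ (Fin N)) :
    ‖LinearMap.adjoint φ.toLinearMap z‖ ≤ ‖z‖ := by
  set u := LinearMap.adjoint φ.toLinearMap z with hu
  have h : ‖u‖ * ‖u‖ ≤ ‖z‖ * ‖u‖ := by
    rw [← real_inner_self_eq_norm_mul_norm]
    conv_lhs => rw [hu]
    rw [LinearMap.adjoint_inner_left]
    refine (real_inner_le_norm _ _).trans (le_of_eq ?_)
    rw [← hu]
    congr 1
    exact φ.norm_map u
  by_contra hlt
  push Not at hlt
  nlinarith [norm_nonneg z]

/-- The orthogonal projection onto the range of φ is φφ*, and φ preserves volume. Projections onto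
subspaces can therefore be treated as adjoints with values in a fixed ℝ^k. -/
lemma lebesgueOn_range_image {k N : ℕ}
    (φ : EuclideanSpace ℝ (Fin k) →ₗᵢ[ℝ] EuclideanSpace ℝ (Fin N))
    (S : Set (EuclideanSpace ℝ (Fin N))) :
    lebesgueOn φ.toLinearMap.range (φ.toLinearMap.range.orthogonalProjectionOnto '' S) =
      volume (LinearMap.adjoint φ.toLinearMap '' S) := by
  set G := φ.toLinearMap.range with hG
  let : MeasureSpace G := measureSpaceOfInnerProductSpace
  have h1 : lebesgueOn G = (volume : Measure G) :=
    OrthonormalBasis.addHaar_eq_volume _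
  let φe : EuclideanSpace ℝ (Fin k) ≃ₗᵢ[ℝ] G := φ.equivRange
  have hproj : ∀ z, G.orthogonalProjectionOnto z = φe (LinearMap.adjoint φ.toLinearMap z) := by
    intro z
    apply Subtype.ext
    change G.starProjection z = φ _
    refine Submodule.eq_starProjection_of_mem_of_inner_eq_zero ⟨_, rfl⟩ ?_
    rintro _ ⟨v, rfl⟩
    rw [inner_sub_left, LinearIsometry.coe_toLinearMap, φ.inner_map_map,
      LinearMap.adjoint_inner_left]
    exact sub_self _
  have h2 : G.orthogonalProjectionOnto '' S = φe '' (LinearMap.adjoint φ.toLinearMap '' S) := by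
    rw [Set.image_image]
    exact Set.image_congr fun z _ => hproj z
  rw [h1, h2]
  have h3 := (φe.symm.measurePreserving).measure_preimage_equiv
    (f := φe.symm.toHomeomorph.toMeasurableEquiv) (LinearMap.adjoint φ.toLinearMap '' S)
  rw [← h3]
  congr 1
  exact (φe.toEquiv.image_eq_preimage_symm _)

/-- Without boundedness the real `sSup` would be the default 0 and would bound nothing. -/
lemma volumeNumber_set_bddAbove {N : ℕ} (k : ℕ) {B : Set (EuclideanSpace ℝ (Fin N))}
    (hB : B ⊆ Metric.closedBall 0 1) :
    BddAbove {v : ℝ | ∃ G : Submodule ℝ (EuclideanSpace ℝ (Fin N)), Module.finrank ℝ G = k ∧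
      v = ((lebesgueOn G).real (G.orthogonalProjectionOnto '' B) /
      (lebesgueOn G).real (G.orthogonalProjectionOnto '' Metric.closedBall 0 1)) ^
        (1 / (k : ℝ))} := by
  refine ⟨1, ?_⟩
  rintro v ⟨G, -, rfl⟩
  refine Real.rpow_le_one (by positivity) ?_ (by positivity)
  refine div_le_one_of_le₀ ?_ measureReal_nonneg
  have : IsFiniteMeasureOnCompacts (lebesgueOn G) := by
    unfold lebesgueOn; infer_instance
  refine measureReal_mono (Set.image_mono hB) ?_
  exact ((isCompact_closedBall _ _).image
    G.orthogonalProjectionOnto.continuous).measure_lt_top.ne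

lemma volumeNumber_nonneg {N : ℕ} (k : ℕ) (B : Set (EuclideanSpace ℝ (Fin N))) :
    0 ≤ volumeNumber k B := by
  refine Real.sSup_nonneg ?_
  rintro v ⟨G, -, rfl⟩
  positivity

/-- The volume number bounds the volumes of all `k`-dimensional projections. -/
lemma volume_adjoint_image_le {k N : ℕ} (hk : 0 < k) {B : Set (EuclideanSpace ℝ (Fin N))}
    (hB : B ⊆ Metric.closedBall 0 1)
    (φ : EuclideanSpace ℝ (Fin k) →ₗᵢ[ℝ] EuclideanSpace ℝ (Fin N)) :
    volume (LinearMap.adjoint φ.toLinearMap '' B) ≤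
      ENNReal.ofReal (volumeNumber k B) ^ k * ballVol k := by
  set G := φ.toLinearMap.range with hG
  have hfr : Module.finrank ℝ G = k := by
    rw [hG, LinearMap.finrank_range_of_inj φ.injective, finrank_euclideanSpace_fin]
  have hball : LinearMap.adjoint φ.toLinearMap '' Metric.closedBall 0 1 =
      Metric.closedBall (0 : EuclideanSpace ℝ (Fin k)) 1 := by
    ext u
    rw [mem_closedBall_zero_iff]
    constructor
    · rintro ⟨z, hz, rfl⟩
      exact (norm_adjoint_linearIsometry_le φ z).trans (mem_closedBall_zero_iff.1 hz)
    · intro hu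
      exact ⟨φ u, by rwa [mem_closedBall_zero_iff, φ.norm_map],
        adjoint_linearIsometry_apply φ u⟩
  have hle := le_csSup (volumeNumber_set_bddAbove k hB) ⟨G, hfr, rfl⟩
  change _ ≤ volumeNumber k B at hle
  rw [measureReal_def, measureReal_def, hG, lebesgueOn_range_image, lebesgueOn_range_image,
    hball] at hle
  change ((volume (LinearMap.adjoint φ.toLinearMap '' B)).toReal / (ballVol k).toReal) ^ _ ≤ _
    at hle
  have hv : 0 < (ballVol k).toReal := ENNReal.toReal_pos (ballVol_ne_zero k) (ballVol_ne_top k)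
  have hne : volume (LinearMap.adjoint φ.toLinearMap '' B) ≠ ⊤ := by
    refine ne_top_of_le_ne_top (ballVol_ne_top k) ?_
    rw [ballVol, ← hball]
    exact measure_mono (Set.image_mono hB)
  rw [one_div, Real.rpow_inv_le_iff_of_pos (by positivity) (volumeNumber_nonneg k B)
    (by exact_mod_cast hk), Real.rpow_natCast, div_le_iff₀ hv] at hle
  rw [← ENNReal.ofReal_toReal hne, ← ENNReal.ofReal_toReal (ballVol_ne_top k),
    ← ENNReal.ofReal_pow (volumeNumber_nonneg k B), ← ENNReal.ofReal_mul (by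
      exact pow_nonneg (volumeNumber_nonneg k B) k)]
  exact ENNReal.ofReal_le_ofReal hle

/-- If a `k`-dimensional projection of `B` contains a ball of radius `r`, then `r ≤ V_k(B)`. -/
lemma le_volumeNumber {k N : ℕ} (hk : 0 < k) {B : Set (EuclideanSpace ℝ (Fin N))}
    (hB : B ⊆ Metric.closedBall 0 1)
    (φ : EuclideanSpace ℝ (Fin k) →ₗᵢ[ℝ] EuclideanSpace ℝ (Fin N)) {r : ℝ} (hr : 0 ≤ r)
    (h : ∀ u, ‖u‖ ≤ r → u ∈ LinearMap.adjoint φ.toLinearMap '' B) : r ≤ volumeNumber k B := by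
  have h1 : volume (Metric.closedBall (0 : EuclideanSpace ℝ (Fin k)) r) ≤
      volume (LinearMap.adjoint φ.toLinearMap '' B) :=
    measure_mono fun u hu => h u (mem_closedBall_zero_iff.1 hu)
  rw [volume_closedBall_zero hr] at h1
  have h2 := h1.trans (volume_adjoint_image_le hk hB φ)
  rw [ENNReal.mul_le_mul_iff_left (ballVol_ne_zero k) (ballVol_ne_top k),
    ENNReal.pow_le_pow_left_iff hk.ne'] at h2
  exact (ENNReal.ofReal_le_ofReal_iff (volumeNumber_nonneg k B)).1 h2

/-- The isometry onto the span of an orthonormal family. -/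
noncomputable def orthonormalIsometry {k N : ℕ} (c : Fin k → EuclideanSpace ℝ (Fin N))
    (hc : Orthonormal ℝ c) : EuclideanSpace ℝ (Fin k) →ₗᵢ[ℝ] EuclideanSpace ℝ (Fin N) where
  toLinearMap := tupleMap c
  norm_map' u := by
    have : ‖tupleMap c u‖ ^ 2 = ‖u‖ ^ 2 := by
      rw [← real_inner_self_eq_norm_sq, tupleMap_apply, hc.inner_sum, EuclideanSpace.norm_sq_eq]
      simp [sq]
    exact (pow_left_inj₀ (norm_nonneg _) (norm_nonneg _) two_ne_zero).1 this

lemma orthonormalIsometry_apply {k N : ℕ} (c : Fin k → EuclideanSpace ℝ (Fin N))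
    (hc : Orthonormal ℝ c) (u : EuclideanSpace ℝ (Fin k)) :
    orthonormalIsometry c hc u = ∑ j, u j • c j := rfl

/-- Every subspace of dimension at least `k` contains an isometric copy of `ℝ^k`. -/
lemma exists_linearIsometry_mem {k N : ℕ} (G : Submodule ℝ (EuclideanSpace ℝ (Fin N)))
    (hk : k ≤ Module.finrank ℝ G) :
    ∃ φ : EuclideanSpace ℝ (Fin k) →ₗᵢ[ℝ] EuclideanSpace ℝ (Fin N), ∀ u, φ u ∈ G := by
  let b := stdOrthonormalBasis ℝ G
  have hc : Orthonormal ℝ (fun j : Fin k => (b (Fin.castLE hk j) : EuclideanSpace ℝ (Fin N))) :=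
    (b.orthonormal.comp_linearIsometry G.subtypeₗᵢ).comp _ (Fin.castLE_injective hk)
  refine ⟨orthonormalIsometry _ hc, fun u => ?_⟩
  rw [orthonormalIsometry_apply]
  exact G.sum_mem fun j _ => G.smul_mem _ (b _).2

/-- All but `k` axes of an ellipsoid inside `B` are at most `2 V_k(B)`. -/
lemma exists_submodule_norm_le {k N : ℕ} (hk : 0 < k) {B : Set (EuclideanSpace ℝ (Fin N))}
    (hB : B ⊆ Metric.closedBall 0 1) (hV : 0 < volumeNumber k B)
    (A : EuclideanSpace ℝ (Fin N) →ₗ[ℝ] EuclideanSpace ℝ (Fin N))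
    (hA : ∀ y, ‖y‖ ≤ 1 → A y ∈ B) :
    ∃ M : Submodule ℝ (EuclideanSpace ℝ (Fin N)), N ≤ Module.finrank ℝ M + k ∧
      ∀ y ∈ M, ‖A y‖ ≤ 2 * volumeNumber k B * ‖y‖ := by
  classical
  set V := volumeNumber k B with hVdef
  -- Singular value decomposition: the eigenvalues of A*A are the squared axes, and A maps its
  -- eigenbasis to an orthogonal family.
  have hT : (LinearMap.adjoint A ∘ₗ A).IsSymmetric := by
    intro x y
    simp [LinearMap.adjoint_inner_left, LinearMap.adjoint_inner_right]
  set b := hT.eigenvectorBasis finrank_euclideanSpace_fin with hb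
  set ev := hT.eigenvalues finrank_euclideanSpace_fin with hev
  have hip : ∀ x i, inner ℝ (A x) (A (b i)) = ev i * inner ℝ x (b i) := by
    intro x i
    have h1 : (LinearMap.adjoint A ∘ₗ A) (b i) = ev i • b i := by
      exact hT.apply_eigenvectorBasis finrank_euclideanSpace_fin i
    rw [← LinearMap.adjoint_inner_right, ← LinearMap.comp_apply, h1, real_inner_smul_right]
  have hbin : ∀ i j, inner ℝ (b i) (b j) = if i = j then (1 : ℝ) else 0 :=
    orthonormal_iff_ite.1 b.orthonormal
  have hnormsq : ∀ y, ‖A y‖ ^ 2 = ∑ i, ev i * inner ℝ y (b i) ^ 2 := by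
    intro y
    have hAy : A y = ∑ i, inner ℝ (b i) y • A (b i) := by
      conv_lhs => rw [← b.sum_repr' y, map_sum]
      simp only [map_smul]
    rw [← real_inner_self_eq_norm_sq]
    calc inner ℝ (A y) (A y) = inner ℝ (A y) (∑ i, inner ℝ (b i) y • A (b i)) := by rw [← hAy]
      _ = _ := by
        rw [inner_sum]
        refine Finset.sum_congr rfl fun i _ => ?_
        rw [real_inner_smul_right, hip, real_inner_comm]
        ring
  set I : Finset (Fin N) := Finset.univ.filter fun i => 4 * V ^ 2 < ev i with hI
  have hcard : I.card ≤ k := by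
    by_contra hlt
    push Not at hlt
    let f : Fin k → Fin N := fun j => (I.equivFin.symm (Fin.castLE hlt.le j) : Fin N)
    have hfinj : Function.Injective f :=
      Subtype.val_injective.comp (I.equivFin.symm.injective.comp (Fin.castLE_injective _))
    have hfI : ∀ j, 4 * V ^ 2 < ev (f j) := fun j =>
      (Finset.mem_filter.1 (I.equivFin.symm (Fin.castLE hlt.le j)).2).2
    have hpos : ∀ j, 0 < ev (f j) := fun j => lt_trans (by positivity) (hfI j)
    have hc : Orthonormal ℝ (fun j => (√(ev (f j)))⁻¹ • A (b (f j))) := by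
      rw [orthonormal_iff_ite]
      intro i j
      rw [real_inner_smul_left, real_inner_smul_right, hip, hbin]
      by_cases hij : i = j
      · subst hij
        have h1 : √(ev (f i)) ≠ 0 := (Real.sqrt_pos.2 (hpos i)).ne'
        simp only [if_true, mul_one]
        rw [← mul_assoc, ← mul_inv, Real.mul_self_sqrt (hpos i).le,
          inv_mul_cancel₀ (hpos i).ne']
      · rw [if_neg (fun h => hij (hfinj h)), if_neg hij]
        ring
    -- More than k axes longer than 2V would put a k-dimensional ball of radius 2V inside B, forcing
    -- 2V ≤ V.
    have := le_volumeNumber hk hB (orthonormalIsometry _ hc) (r := 2 * V) (by positivity) (by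
      intro u hu
      set y : EuclideanSpace ℝ (Fin N) := ∑ j, (u j * (√(ev (f j)))⁻¹) • b (f j) with hy
      have hAy : A y = orthonormalIsometry _ hc u := by
        rw [hy, map_sum, orthonormalIsometry_apply]
        simp only [map_smul, mul_smul]
      refine ⟨A y, hA y ?_, ?_⟩
      · have h1 : ‖y‖ ^ 2 = ∑ j, (u j * (√(ev (f j)))⁻¹) ^ 2 := by
          rw [← real_inner_self_eq_norm_sq, hy]
          have := (b.orthonormal.comp f hfinj).inner_sum
            (fun j => u j * (√(ev (f j)))⁻¹) (fun j => u j * (√(ev (f j)))⁻¹) Finset.univ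
          simp only [Function.comp] at this
          rw [this]
          simp [sq]
        have h2 : ‖y‖ ^ 2 * (4 * V ^ 2) ≤ 4 * V ^ 2 := by
          calc ‖y‖ ^ 2 * (4 * V ^ 2) ≤ ‖u‖ ^ 2 := by
                rw [h1, EuclideanSpace.norm_sq_eq, Finset.sum_mul]
                refine Finset.sum_le_sum fun j _ => ?_
                rw [mul_pow, inv_pow, Real.sq_sqrt (hpos j).le, Real.norm_eq_abs, sq_abs,
                  mul_assoc]
                refine mul_le_of_le_one_right (sq_nonneg _) ?_
                rw [inv_mul_le_iff₀ (hpos j), mul_one]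
                exact (hfI j).le
            _ ≤ (2 * V) ^ 2 := by gcongr
            _ = 4 * V ^ 2 := by ring
        have h3 : ‖y‖ ^ 2 ≤ 1 := by
          have : 0 < 4 * V ^ 2 := by positivity
          nlinarith
        exact (sq_le_one_iff₀ (norm_nonneg _)).1 h3
      · rw [hAy]; exact adjoint_linearIsometry_apply _ u)
    linarith
  refine ⟨(Submodule.span ℝ (I.image b : Set (EuclideanSpace ℝ (Fin N))))ᗮ, ?_, ?_⟩
  · have h1 := Submodule.finrank_add_finrank_orthogonal
      (Submodule.span ℝ (I.image b : Set (EuclideanSpace ℝ (Fin N))))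
    have h2 := finrank_span_finset_le_card (R := ℝ) (I.image b)
    have h3 := Finset.card_image_le (s := I) (f := b)
    rw [finrank_euclideanSpace_fin] at h1
    simp only [Set.finrank] at h2
    omega
  · intro y hy
    have hzero : ∀ i ∈ I, inner ℝ y (b i) = 0 := by
      intro i hi
      rw [real_inner_comm]
      exact (Submodule.mem_orthogonal _ _).1 hy _
        (Submodule.subset_span (Finset.mem_coe.2 (Finset.mem_image_of_mem _ hi)))
    have h1 : ‖A y‖ ^ 2 ≤ (2 * V * ‖y‖) ^ 2 := by
      rw [hnormsq, mul_pow, ← b.sum_sq_inner_left y, Finset.mul_sum]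
      refine Finset.sum_le_sum fun i _ => ?_
      by_cases hi : i ∈ I
      · rw [hzero i hi]; simp
      · have : ev i ≤ 4 * V ^ 2 := by
          by_contra hlt
          exact hi (Finset.mem_filter.2 ⟨Finset.mem_univ _, not_le.1 hlt⟩)
        have h4 : (2 * V) ^ 2 = 4 * V ^ 2 := by ring
        rw [h4]
        gcongr
    exact (pow_le_pow_iff_left₀ (norm_nonneg _) (by positivity) two_ne_zero).1 h1

/-! ### The random quotient map [I | X] -/

/-- The first `n` coordinates. -/
noncomputable def headProj (n m : ℕ) :
    EuclideanSpace ℝ (Fin (n + m)) →ₗ[ℝ] EuclideanSpace ℝ (Fin n) where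
  toFun z := WithLp.toLp 2 fun i => z (Fin.castAdd m i)
  map_add' _ _ := rfl
  map_smul' _ _ := rfl

/-- The last `m` coordinates. -/
noncomputable def tailProj (n m : ℕ) :
    EuclideanSpace ℝ (Fin (n + m)) →ₗ[ℝ] EuclideanSpace ℝ (Fin m) where
  toFun z := WithLp.toLp 2 fun i => z (Fin.natAdd n i)
  map_add' _ _ := rfl
  map_smul' _ _ := rfl

lemma headProj_apply {n m : ℕ} (z : EuclideanSpace ℝ (Fin (n + m))) (i : Fin n) :
    headProj n m z i = z (Fin.castAdd m i) := rfl

lemma tailProj_apply {n m : ℕ} (z : EuclideanSpace ℝ (Fin (n + m))) (j : Fin m) :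
    tailProj n m z j = z (Fin.natAdd n j) := rfl

lemma norm_sq_eq_headProj_add_tailProj {n m : ℕ} (z : EuclideanSpace ℝ (Fin (n + m))) :
    ‖z‖ ^ 2 = ‖headProj n m z‖ ^ 2 + ‖tailProj n m z‖ ^ 2 := by
  simp only [EuclideanSpace.norm_sq_eq, Fin.sum_univ_add, headProj_apply, tailProj_apply]

lemma norm_headProj_le {n m : ℕ} (z : EuclideanSpace ℝ (Fin (n + m))) :
    ‖headProj n m z‖ ≤ ‖z‖ := by
  refine (pow_le_pow_iff_left₀ (norm_nonneg _) (norm_nonneg _) two_ne_zero).1 ?_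
  rw [norm_sq_eq_headProj_add_tailProj z]
  linarith [sq_nonneg ‖tailProj n m z‖]

lemma norm_tailProj_le {n m : ℕ} (z : EuclideanSpace ℝ (Fin (n + m))) :
    ‖tailProj n m z‖ ≤ ‖z‖ := by
  refine (pow_le_pow_iff_left₀ (norm_nonneg _) (norm_nonneg _) two_ne_zero).1 ?_
  rw [norm_sq_eq_headProj_add_tailProj z]
  linarith [sq_nonneg ‖headProj n m z‖]

/-- The inclusion as the first `n` coordinates. -/
noncomputable def headIncl (n m : ℕ) :
    EuclideanSpace ℝ (Fin n) →ₗᵢ[ℝ] EuclideanSpace ℝ (Fin (n + m)) where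
  toFun x := WithLp.toLp 2 (Fin.addCases (fun i => x i) fun _ => 0)
  map_add' x y := by
    ext i
    refine Fin.addCases (fun i => ?_) (fun i => ?_) i <;> simp
  map_smul' r x := by
    ext i
    refine Fin.addCases (fun i => ?_) (fun i => ?_) i <;> simp
  norm_map' x := by
    refine (pow_left_inj₀ (norm_nonneg _) (norm_nonneg _) two_ne_zero).1 ?_
    simp [EuclideanSpace.norm_sq_eq, Fin.sum_univ_add]

lemma headProj_headIncl {n m : ℕ} (x : EuclideanSpace ℝ (Fin n)) :
    headProj n m (headIncl n m x) = x := by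
  ext i; simp [headProj_apply, headIncl]

lemma tailProj_headIncl {n m : ℕ} (x : EuclideanSpace ℝ (Fin n)) :
    tailProj n m (headIncl n m x) = 0 := by
  ext i; simp [tailProj_apply, headIncl]

lemma inner_headIncl {n m : ℕ} (x : EuclideanSpace ℝ (Fin n))
    (z : EuclideanSpace ℝ (Fin (n + m))) :
    inner ℝ (headIncl n m x) z = inner ℝ x (headProj n m z) := by
  simp [PiLp.inner_apply, Fin.sum_univ_add, headIncl, headProj_apply]

/-- The projection of the first block of B is itself a k-dimensional orthogonal projection of B, so
V_k(B) controls its volume. -/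
lemma adjoint_headIncl_comp {k n m : ℕ}
    (χ : EuclideanSpace ℝ (Fin k) →ₗᵢ[ℝ] EuclideanSpace ℝ (Fin n))
    (z : EuclideanSpace ℝ (Fin (n + m))) :
    LinearMap.adjoint ((headIncl n m).comp χ).toLinearMap z =
      LinearMap.adjoint χ.toLinearMap (headProj n m z) := by
  refine ext_inner_left ℝ fun u => ?_
  rw [LinearMap.adjoint_inner_right, LinearMap.adjoint_inner_right]
  exact inner_headIncl _ _

/-- The map `[I | X]`. -/
noncomputable def quotMap {n m : ℕ} (X : Fin m → EuclideanSpace ℝ (Fin n)) :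
    EuclideanSpace ℝ (Fin (n + m)) →ₗ[ℝ] EuclideanSpace ℝ (Fin n) :=
  headProj n m + tupleMap X ∘ₗ tailProj n m

lemma quotMap_apply {n m : ℕ} (X : Fin m → EuclideanSpace ℝ (Fin n))
    (z : EuclideanSpace ℝ (Fin (n + m))) :
    quotMap X z = headProj n m z + tupleMap X (tailProj n m z) := rfl

lemma quotMap_headIncl {n m : ℕ} (X : Fin m → EuclideanSpace ℝ (Fin n))
    (x : EuclideanSpace ℝ (Fin n)) : quotMap X (headIncl n m x) = x := by
  rw [quotMap_apply, headProj_headIncl, tailProj_headIncl, map_zero, add_zero]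

lemma norm_quotMap_le {n m : ℕ} {X : Fin m → EuclideanSpace ℝ (Fin n)} (hX : X ∈ opBall n m)
    (z : EuclideanSpace ℝ (Fin (n + m))) : ‖quotMap X z‖ ≤ 2 * ‖z‖ := by
  rw [quotMap_apply]
  linarith [norm_add_le (headProj n m z) (tupleMap X (tailProj n m z)), norm_headProj_le z,
    hX (tailProj n m z), norm_tailProj_le z]

lemma quotMap_single_castAdd {n m : ℕ} (X : Fin m → EuclideanSpace ℝ (Fin n)) (i : Fin n) :
    quotMap X (EuclideanSpace.single (Fin.castAdd m i) 1) = EuclideanSpace.single i 1 := by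
  rw [quotMap_apply]
  have h1 : headProj n m (EuclideanSpace.single (Fin.castAdd m i) 1) =
      EuclideanSpace.single i 1 := by
    ext l; simp [headProj_apply]
  have h2 : tailProj n m (EuclideanSpace.single (Fin.castAdd m i) 1) = 0 := by
    ext l
    have : Fin.natAdd n l ≠ Fin.castAdd m i := by
      intro h; have := congrArg Fin.val h; simp at this; omega
    simp [tailProj_apply, this]
  rw [h1, h2, map_zero, add_zero]

lemma quotMap_single_natAdd {n m : ℕ} (X : Fin m → EuclideanSpace ℝ (Fin n)) (j : Fin m) :
    quotMap X (EuclideanSpace.single (Fin.natAdd n j) 1) = X j := by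
  rw [quotMap_apply]
  have h1 : tailProj n m (EuclideanSpace.single (Fin.natAdd n j) 1) =
      EuclideanSpace.single j 1 := by
    ext l; simp [tailProj_apply]
  have h2 : headProj n m (EuclideanSpace.single (Fin.natAdd n j) 1) = 0 := by
    ext l
    have : Fin.castAdd m l ≠ Fin.natAdd n j := by
      intro h; have := congrArg Fin.val h; simp at this; omega
    simp [headProj_apply, this]
  rw [h1, h2, zero_add, tupleMap_single]

lemma continuous_quotMap_apply {Z : Type*} [TopologicalSpace Z] {n m : ℕ}
    {f : Z → Fin m → EuclideanSpace ℝ (Fin n)} {g : Z → EuclideanSpace ℝ (Fin (n + m))}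
    (hf : Continuous f) (hg : Continuous g) : Continuous fun z => quotMap (f z) (g z) := by
  simp only [quotMap_apply, tupleMap_apply]
  have h1 : Continuous fun z => headProj n m (g z) :=
    (headProj n m).continuous_of_finiteDimensional.comp hg
  have h2 : Continuous fun z => tailProj n m (g z) :=
    (tailProj n m).continuous_of_finiteDimensional.comp hg
  fun_prop

/-! ### Volume of the exceptional set of a fixed operator -/

lemma isClosed_exists_mem_of_isCompact {X Y : Type*} [TopologicalSpace X] [TopologicalSpace Y]
    {K : Set Y} (hK : IsCompact K) {S : Set (X × Y)} (hS : IsClosed S) :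
    IsClosed {x | ∃ y ∈ K, (x, y) ∈ S} := by
  have : CompactSpace K := isCompact_iff_compactSpace.1 hK
  have h1 : IsClosed ((fun z : X × K => (z.1, (z.2 : Y))) ⁻¹' S) :=
    hS.preimage (by fun_prop)
  have h2 := isClosedMap_fst_of_compactSpace (X := X) (Y := K) _ h1
  convert h2 using 1
  ext x
  simp

/-- The tuples `X` for which the operator `[I | X] S` maps the columns `X j`, `j ∈ J`, into
`σ [I | X] B`, up to vectors from the range of `U`. -/
def badSet {n m d : ℕ} (B : Set (EuclideanSpace ℝ (Fin (n + m))))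
    (S : EuclideanSpace ℝ (Fin n) →ₗ[ℝ] EuclideanSpace ℝ (Fin (n + m)))
    (U : EuclideanSpace ℝ (Fin d) →ₗ[ℝ] EuclideanSpace ℝ (Fin n)) (J : Finset (Fin m))
    (σ r : ℝ) : Set (Fin m → EuclideanSpace ℝ (Fin n)) :=
  {X | X ∈ opBall n m ∧ ∀ j ∈ J, ∃ y ∈ B ×ˢ Metric.closedBall 0 r,
    quotMap X (S (X j)) = σ • quotMap X y.1 + U y.2}

/-- Closedness supplies measurability. The radius r serves only this purpose in the volume estimate:
it makes the existential quantifier range over a compact set. -/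
lemma isClosed_badSet {n m d : ℕ} {B : Set (EuclideanSpace ℝ (Fin (n + m)))} (hB : IsCompact B)
    (S : EuclideanSpace ℝ (Fin n) →ₗ[ℝ] EuclideanSpace ℝ (Fin (n + m)))
    (U : EuclideanSpace ℝ (Fin d) →ₗ[ℝ] EuclideanSpace ℝ (Fin n)) (J : Finset (Fin m))
    (σ r : ℝ) : IsClosed (badSet B S U J σ r) := by
  have : badSet B S U J σ r = opBall n m ∩ ⋂ j ∈ J,
      {X | ∃ y ∈ B ×ˢ Metric.closedBall 0 r, (X, y) ∈
        {z : (Fin m → EuclideanSpace ℝ (Fin n)) ×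
          (EuclideanSpace ℝ (Fin (n + m)) × EuclideanSpace ℝ (Fin d)) |
          quotMap z.1 (S (z.1 j)) = σ • quotMap z.1 z.2.1 + U z.2.2}} := by
    ext X; simp [badSet]
  rw [this]
  refine (isClosed_opBall n m).inter (isClosed_biInter fun j _ =>
    isClosed_exists_mem_of_isCompact (hB.prod (isCompact_closedBall _ _)) (isClosed_eq ?_ ?_))
  · exact continuous_quotMap_apply continuous_fst
      (S.continuous_of_finiteDimensional.comp (by fun_prop))
  · exact ((continuous_quotMap_apply continuous_fst (by fun_prop)).const_smul σ).add
      (U.continuous_of_finiteDimensional.comp (by fun_prop))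

/-- Compress Λ₀ to the complement of G, the range of φ; by mixing, the compression still expands by
1/4. Requiring its values to be orthogonal to the wⱼ and to the range of U costs at most m + d
dimensions, so k survive. χ parametrises the resulting image, hence χ* annihilates G, all wⱼ and U,
and loses nothing on that image. -/
lemma exists_isometries_of_mixing {k κ n m d : ℕ}
    (φ : EuclideanSpace ℝ (Fin κ) →ₗᵢ[ℝ] EuclideanSpace ℝ (Fin n))
    (Λ₀ : EuclideanSpace ℝ (Fin κ) →ₗ[ℝ] EuclideanSpace ℝ (Fin n))
    (hΛ₀ : ∀ u v, ‖u‖ ≤ 4 * ‖Λ₀ u - φ v‖)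
    (w : Fin m → EuclideanSpace ℝ (Fin n))
    (U : EuclideanSpace ℝ (Fin d) →ₗ[ℝ] EuclideanSpace ℝ (Fin n)) (hκ : k + m + d ≤ κ) :
    ∃ (φ₃ : EuclideanSpace ℝ (Fin k) →ₗᵢ[ℝ] EuclideanSpace ℝ (Fin κ))
      (χ : EuclideanSpace ℝ (Fin k) →ₗᵢ[ℝ] EuclideanSpace ℝ (Fin n)),
      (∀ u, LinearMap.adjoint χ.toLinearMap (φ u) = 0) ∧
      (∀ j, LinearMap.adjoint χ.toLinearMap (w j) = 0) ∧
      (∀ v, LinearMap.adjoint χ.toLinearMap (U v) = 0) ∧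
      ∀ u, ‖u‖ ≤ 4 * ‖LinearMap.adjoint χ.toLinearMap (Λ₀ (φ₃ u))‖ := by
  set G := φ.toLinearMap.range with hG
  let Λ : EuclideanSpace ℝ (Fin κ) →ₗ[ℝ] EuclideanSpace ℝ (Fin n) :=
    (Gᗮ.starProjection : EuclideanSpace ℝ (Fin n) →ₗ[ℝ] EuclideanSpace ℝ (Fin n)) ∘ₗ Λ₀
  have hΛG : ∀ u, Λ u ∈ Gᗮ := fun u => Submodule.starProjection_apply_mem _ _
  have hΛsub : ∀ u, Λ₀ u - Λ u ∈ G := by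
    intro u
    have : Λ₀ u - Λ u = G.starProjection (Λ₀ u) := by
      have h := G.starProjection_add_starProjection_orthogonal (Λ₀ u)
      exact sub_eq_of_eq_add h.symm
    rw [this]
    exact Submodule.starProjection_apply_mem _ _
  have hΛ : ∀ u, ‖u‖ ≤ 4 * ‖Λ u‖ := by
    intro u
    obtain ⟨v, hv⟩ := hΛsub u
    have : Λ u = Λ₀ u - φ v := by
      change φ v = _ at hv
      rw [hv]; abel
    rw [this]
    exact hΛ₀ u v
  set W := Submodule.span ℝ (Set.range w) ⊔ U.range with hW
  have hWdim : Module.finrank ℝ W ≤ m + d := by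
    refine (Submodule.finrank_add_le_finrank_add_finrank _ _).trans (add_le_add ?_ ?_)
    · simpa [Set.finrank] using finrank_range_le_card (R := ℝ) w
    · simpa using LinearMap.finrank_range_le U
  -- The kernel of Ψ consists of the vectors whose image under Λ is orthogonal to W.
  let Ψ : EuclideanSpace ℝ (Fin κ) →ₗ[ℝ] W :=
    (W.orthogonalProjectionOnto : EuclideanSpace ℝ (Fin n) →ₗ[ℝ] W) ∘ₗ Λ
  have hker : k ≤ Module.finrank ℝ Ψ.ker := by
    have h1 := Ψ.finrank_range_add_finrank_ker
    have h2 := Submodule.finrank_le Ψ.range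
    rw [finrank_euclideanSpace_fin] at h1
    omega
  obtain ⟨φ₃, hφ₃⟩ := exists_linearIsometry_mem _ hker
  set M := (Λ ∘ₗ φ₃.toLinearMap).range with hM
  have hinj : Function.Injective (Λ ∘ₗ φ₃.toLinearMap) := by
    rw [← LinearMap.ker_eq_bot, LinearMap.ker_eq_bot']
    intro u hu
    have h := hΛ (φ₃ u)
    change Λ (φ₃ u) = 0 at hu
    rw [hu, norm_zero, mul_zero, φ₃.norm_map] at h
    exact norm_le_zero_iff.1 h
  have hMdim : Module.finrank ℝ M = k := by
    rw [hM, LinearMap.finrank_range_of_inj hinj, finrank_euclideanSpace_fin]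
  obtain ⟨χ, hχ⟩ := exists_linearIsometry_mem M hMdim.ge
  have hχM : χ.toLinearMap.range = M := by
    refine Submodule.eq_of_le_of_finrank_eq ?_ ?_
    · rintro _ ⟨u, rfl⟩; exact hχ u
    · rw [LinearMap.finrank_range_of_inj χ.injective, finrank_euclideanSpace_fin, hMdim]
  have hMG : ∀ z ∈ M, z ∈ Gᗮ := by
    rintro _ ⟨u, rfl⟩; exact hΛG _
  have hMW : ∀ z ∈ M, z ∈ Wᗮ := by
    rintro _ ⟨u, rfl⟩
    have h := hφ₃ u
    rw [LinearMap.mem_ker] at h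
    exact (Submodule.orthogonalProjectionOnto_eq_zero_iff).1 h
  have hzero : ∀ x, (∀ z ∈ M, inner ℝ x z = 0) → LinearMap.adjoint χ.toLinearMap x = 0 := by
    intro x hx
    refine ext_inner_right ℝ fun u => ?_
    rw [LinearMap.adjoint_inner_left, inner_zero_left]
    exact hx _ (hχ u)
  have hGzero : ∀ x ∈ G, LinearMap.adjoint χ.toLinearMap x = 0 := fun x hx =>
    hzero x fun z hz => (Submodule.mem_orthogonal _ _).1 (hMG z hz) x hx
  have hWzero : ∀ x ∈ W, LinearMap.adjoint χ.toLinearMap x = 0 := fun x hx =>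
    hzero x fun z hz => (Submodule.mem_orthogonal _ _).1 (hMW z hz) x hx
  refine ⟨φ₃, χ, fun u => hGzero _ ⟨u, rfl⟩,
    fun j => hWzero _ (Submodule.mem_sup_left (Submodule.subset_span ⟨j, rfl⟩)),
    fun v => hWzero _ (Submodule.mem_sup_right ⟨v, rfl⟩), fun u => ?_⟩
  have h1 : LinearMap.adjoint χ.toLinearMap (Λ₀ (φ₃ u)) =
      LinearMap.adjoint χ.toLinearMap (Λ (φ₃ u)) := by
    rw [← sub_eq_zero, ← map_sub]
    exact hGzero _ (hΛsub _)
  have h2 : Λ (φ₃ u) ∈ χ.toLinearMap.range := by rw [hχM]; exact ⟨u, rfl⟩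
  obtain ⟨y, hy⟩ := h2
  rw [h1, ← hy, LinearIsometry.coe_toLinearMap, adjoint_linearIsometry_apply]
  have h3 := hΛ (φ₃ u)
  rwa [← hy, φ₃.norm_map, LinearIsometry.coe_toLinearMap, χ.norm_map] at h3

/-- Slice along translates of the range of φ: on each slice Λ expands by at least 1/4 onto a
translate of K, which gives (4V)^k. The factor 2^κ pays for base points in the ball of radius 2. -/
lemma volume_unitBall_inter_preimage_le {k κ : ℕ}
    (Λ : EuclideanSpace ℝ (Fin κ) →ₗ[ℝ] EuclideanSpace ℝ (Fin k))
    (φ : EuclideanSpace ℝ (Fin k) →ₗᵢ[ℝ] EuclideanSpace ℝ (Fin κ))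
    (hΛ : ∀ u, ‖u‖ ≤ 4 * ‖Λ (φ u)‖) {K : Set (EuclideanSpace ℝ (Fin k))} (hK : IsClosed K)
    {V : ENNReal} (hKV : volume K ≤ V ^ k * ballVol k) :
    volume {u : EuclideanSpace ℝ (Fin κ) | ‖u‖ ≤ 1 ∧ Λ u ∈ K} ≤
      (4 * V) ^ k * 2 ^ κ * ballVol κ := by
  set D := {u : EuclideanSpace ℝ (Fin κ) | ‖u‖ ≤ 1 ∧ Λ u ∈ K} with hD
  have hDc : IsClosed D :=
    (isClosed_le continuous_norm continuous_const).inter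
      (hK.preimage Λ.continuous_of_finiteDimensional)
  have hslice : ∀ w ∈ Metric.closedBall (0 : EuclideanSpace ℝ (Fin κ)) 2,
      volume {u | u ∈ Metric.closedBall (0 : EuclideanSpace ℝ (Fin k)) 1 ∧ w + φ u ∈ D} ≤
        (4 * V) ^ k * ballVol k := by
    intro w _
    have hsub : {u | u ∈ Metric.closedBall (0 : EuclideanSpace ℝ (Fin k)) 1 ∧ w + φ u ∈ D} ⊆
        (Λ ∘ₗ φ.toLinearMap) ⁻¹' ((fun y => y + Λ w) ⁻¹' K) := by
      intro u hu
      have h1 : Λ (w + φ u) ∈ K := hu.2.2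
      rw [map_add, add_comm] at h1
      exact h1
    have h2 := volume_preimage_le_of_expanding (by norm_num : (0 : ℝ) < 4)
      (Λ ∘ₗ φ.toLinearMap) hΛ ((fun y => y + Λ w) ⁻¹' K)
    rw [measure_preimage_add_right, ENNReal.ofReal_ofNat] at h2
    refine (measure_mono hsub).trans (h2.trans ?_)
    rw [mul_pow, mul_assoc]
    gcongr
  have hball : ∀ w, ∀ u ∈ Metric.closedBall (0 : EuclideanSpace ℝ (Fin k)) 1,
      w + φ u ∈ D → w ∈ Metric.closedBall (0 : EuclideanSpace ℝ (Fin κ)) 2 := by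
    intro w u hu hwu
    rw [mem_closedBall_zero_iff] at *
    have h1 := norm_sub_le (w + φ u) (φ u)
    rw [add_sub_cancel_right, φ.norm_map] at h1
    linarith [hwu.1]
  have h := measure_mul_measure_le_of_slices
    (volume : Measure (EuclideanSpace ℝ (Fin κ))) (volume : Measure (EuclideanSpace ℝ (Fin k)))
    φ.continuous.measurable Metric.isClosed_closedBall.measurableSet hDc.measurableSet
    Metric.isClosed_closedBall.measurableSet hball hslice
  rw [volume_closedBall_zero (zero_le_two (α := ℝ))] at h
  change ballVol k * volume D ≤ _ at h
  rw [mul_comm _ (ballVol k), mul_assoc,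
    ENNReal.mul_le_mul_iff_right (ballVol_ne_zero k) (ballVol_ne_top k)] at h
  refine h.trans (le_of_eq ?_)
  rw [ENNReal.ofReal_ofNat]; ring

/-- Volume estimate for the set of exceptional tuples of a fixed mixing operator. -/
lemma volume_badSet_le {n m d k κ : ℕ} (hk : 0 < k)
    {B : Set (EuclideanSpace ℝ (Fin (n + m)))} (hBc : IsCompact B)
    (hB : B ⊆ Metric.closedBall 0 1)
    (S : EuclideanSpace ℝ (Fin n) →ₗ[ℝ] EuclideanSpace ℝ (Fin (n + m)))
    (U : EuclideanSpace ℝ (Fin d) →ₗ[ℝ] EuclideanSpace ℝ (Fin n)) (J : Finset (Fin m))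
    {σ : ℝ} (hσ : 0 ≤ σ) (r : ℝ)
    (φ : EuclideanSpace ℝ (Fin κ) →ₗᵢ[ℝ] EuclideanSpace ℝ (Fin n))
    (hφ : ∀ u v, ‖u‖ ≤ 4 * ‖headProj n m (S (φ u)) - φ v‖) (hκ : k + m + d ≤ κ) :
    volume (badSet B S U J σ r) ≤
      ENNReal.ofReal (4 * σ * volumeNumber k B) ^ (k * J.card) * 4 ^ (n * m) * ballVol n ^ m := by
  classical
  set V := volumeNumber k B with hV
  have hV0 : 0 ≤ V := volumeNumber_nonneg k B
  set c : ENNReal := (4 * ENNReal.ofReal (σ * V)) ^ k * 2 ^ κ with hc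
  have hκn : κ ≤ n := by
    have := LinearMap.finrank_le_finrank_of_injective (f := φ.toLinearMap) φ.injective
    simpa using this
  -- Each tuple is sliced as w + Φ u with w fixed. Since the columns move only inside the range of
  -- φ, one χ depending on w alone serves the whole slice.
  let Φ : (Fin m → EuclideanSpace ℝ (Fin κ)) → (Fin m → EuclideanSpace ℝ (Fin n)) :=
    fun u j => φ (u j)
  have hΦ : Continuous Φ := continuous_pi fun j => φ.continuous.comp (continuous_apply j)
  have h := measure_mul_measure_le_of_slices
    (volume : Measure (Fin m → EuclideanSpace ℝ (Fin n)))
    (volume : Measure (Fin m → EuclideanSpace ℝ (Fin κ)))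
    (φ := Φ) hΦ.measurable (A := Set.univ.pi fun _ => Metric.closedBall 0 1)
    (MeasurableSet.univ_pi fun _ => Metric.isClosed_closedBall.measurableSet)
    (C := Set.univ.pi fun _ => Metric.closedBall 0 2) (isClosed_badSet hBc S U J σ r).measurableSet
    (MeasurableSet.univ_pi fun _ => Metric.isClosed_closedBall.measurableSet)
    (v := c ^ J.card * ballVol κ ^ m)
    (by
      intro w u hu hwu j _
      have h1 := norm_le_one_of_mem_opBall hwu.1 j
      have h2 := mem_closedBall_zero_iff.1 (hu j (Set.mem_univ j))
      rw [mem_closedBall_zero_iff]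
      have h3 := norm_sub_le (w j + φ (u j)) (φ (u j))
      rw [add_sub_cancel_right, φ.norm_map] at h3
      have h4 : ‖w j + φ (u j)‖ ≤ 1 := h1
      linarith)
    (by
      intro w _
      obtain ⟨φ₃, χ, hχφ, hχw, hχU, hχ⟩ := exists_isometries_of_mixing (k := k) φ
        (headProj n m ∘ₗ S ∘ₗ φ.toLinearMap) hφ w U hκ
      set Λ := LinearMap.adjoint χ.toLinearMap ∘ₗ headProj n m ∘ₗ S ∘ₗ φ.toLinearMap with hΛ
      set K := LinearMap.adjoint ((headIncl n m).comp χ).toLinearMap '' B with hK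
      have hKc : IsCompact K := hBc.image (LinearMap.continuous_of_finiteDimensional _)
      have hKV : volume K ≤ ENNReal.ofReal V ^ k * ballVol k := volume_adjoint_image_le hk hB _
      let q : Fin m → EuclideanSpace ℝ (Fin k) := fun j =>
        LinearMap.adjoint χ.toLinearMap (headProj n m (S (w j)))
      let Kj : Fin m → Set (EuclideanSpace ℝ (Fin k)) := fun j => (fun y => y + q j) ⁻¹' (σ • K)
      have hKjc : ∀ j, IsClosed (Kj j) := fun j =>
        (hKc.smul σ).isClosed.preimage (by fun_prop)
      have hKjV : ∀ j, volume (Kj j) ≤ ENNReal.ofReal (σ * V) ^ k * ballVol k := by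
        intro j
        rw [measure_preimage_add_right, volume_smul_set hσ, ENNReal.ofReal_mul hσ, mul_pow,
          mul_assoc]
        gcongr
      have hsub : {u | u ∈ (Set.univ.pi fun _ : Fin m =>
            Metric.closedBall (0 : EuclideanSpace ℝ (Fin κ)) 1) ∧ w + Φ u ∈ badSet B S U J σ r} ⊆
          Set.univ.pi fun j => if j ∈ J then {u | ‖u‖ ≤ 1 ∧ Λ u ∈ Kj j}
            else Metric.closedBall 0 1 := by
        rintro u ⟨hu, hbad⟩ j -
        have huj := hu j (Set.mem_univ j)
        change u j ∈ if j ∈ J then _ else _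
        split_ifs with hj
        · refine ⟨mem_closedBall_zero_iff.1 huj, ?_⟩
          obtain ⟨⟨b, v⟩, ⟨hb, -⟩, heq⟩ := hbad.2 j hj
          -- χ* annihilates every column of w + Φ u, so it sees only the first block of any vector:
          -- the relation decouples into separate conditions on the uⱼ, j ∈ J.
          have htup : ∀ v, LinearMap.adjoint χ.toLinearMap (tupleMap (w + Φ u) v) = 0 := by
            intro v
            rw [tupleMap_apply, map_sum]
            refine Finset.sum_eq_zero fun l _ => ?_
            rw [map_smul, Pi.add_apply, map_add, hχw, hχφ, add_zero, smul_zero]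
          have heq' := congrArg (LinearMap.adjoint χ.toLinearMap) heq
          rw [quotMap_apply, quotMap_apply, map_add, map_add, map_smul, map_add, htup, htup, hχU,
            add_zero, add_zero, add_zero] at heq'
          refine ⟨LinearMap.adjoint ((headIncl n m).comp χ).toLinearMap b, ⟨b, hb, rfl⟩, ?_⟩
          change σ • _ = Λ (u j) + q j
          rw [adjoint_headIncl_comp, ← heq']
          simp [hΛ, q, Φ, add_comm]
        · exact huj
      refine (measure_mono hsub).trans ?_
      rw [volume_pi_set]
      calc ∏ j, volume (if j ∈ J then {u | ‖u‖ ≤ 1 ∧ Λ u ∈ Kj j}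
            else Metric.closedBall (0 : EuclideanSpace ℝ (Fin κ)) 1)
          ≤ ∏ j, ((if j ∈ J then c else 1) * ballVol κ) := by
            refine Finset.prod_le_prod' fun j _ => ?_
            split_ifs
            · exact volume_unitBall_inter_preimage_le Λ φ₃ hχ (hKjc j) (hKjV j)
            · rw [one_mul]; exact le_rfl
        _ = c ^ J.card * ballVol κ ^ m := by
            rw [Finset.prod_mul_distrib, Finset.prod_const, Finset.card_univ, Fintype.card_fin]
            congr 1
            rw [Finset.prod_ite_mem, Finset.univ_inter, Finset.prod_const])
  rw [volume_pi_set, volume_pi_set] at h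
  simp only [volume_closedBall_zero (by norm_num : (0 : ℝ) ≤ 2), Finset.prod_const,
    Finset.card_univ, Fintype.card_fin] at h
  change ballVol κ ^ m * _ ≤ _ at h
  have hv0 : ballVol κ ^ m ≠ 0 := pow_ne_zero _ (ballVol_ne_zero κ)
  have hvt : ballVol κ ^ m ≠ ⊤ := ENNReal.pow_ne_top (ballVol_ne_top κ)
  rw [mul_comm _ (ballVol κ ^ m), mul_assoc, ENNReal.mul_le_mul_iff_right hv0 hvt] at h
  refine h.trans ?_
  have hJ : J.card ≤ m := by simpa using J.card_le_univ
  have h4 : 4 * ENNReal.ofReal (σ * V) = ENNReal.ofReal (4 * σ * V) := by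
    rw [mul_assoc, ENNReal.ofReal_mul (p := 4) (by norm_num), ENNReal.ofReal_ofNat]
  rw [hc, h4, ENNReal.ofReal_ofNat]
  -- The base 4 in the result is 2 · 2: one factor from the slices in each column, one from the base
  -- points w in balls of radius 2.
  calc _ = ENNReal.ofReal (4 * σ * V) ^ (k * J.card) * 2 ^ (κ * J.card) *
        (2 ^ (n * m) * ballVol n ^ m) := by
        rw [mul_pow, mul_pow, ← pow_mul, ← pow_mul, ← pow_mul]
    _ ≤ ENNReal.ofReal (4 * σ * V) ^ (k * J.card) * 2 ^ (n * m) *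
        (2 ^ (n * m) * ballVol n ^ m) := by
        gcongr
        norm_num
    _ = _ := by
        have : (4 : ENNReal) = 2 * 2 := by norm_num
        rw [this, mul_pow]; ring

/-! ### Nets of operators and of subspaces -/

lemma volume_opBall_ne_top (p q : ℕ) : volume (opBall p q) ≠ ⊤ := by
  refine ne_top_of_le_ne_top ?_ (measure_mono (t := Set.univ.pi fun _ =>
    Metric.closedBall (0 : EuclideanSpace ℝ (Fin p)) 1) fun X hX j _ =>
      mem_closedBall_zero_iff.2 (norm_le_one_of_mem_opBall hX j))
  exact (isCompact_univ_pi fun _ => isCompact_closedBall _ _).measure_lt_top.ne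

lemma volume_opBall_ne_zero (p q : ℕ) : volume (opBall p q) ≠ 0 := by
  have hsub : Metric.closedBall (0 : Fin q → EuclideanSpace ℝ (Fin p)) (1 / (q + 1)) ⊆
      opBall p q := by
    intro X hX v
    rw [mem_closedBall_zero_iff] at hX
    rw [tupleMap_apply]
    calc ‖∑ j, v j • X j‖ ≤ ∑ j, ‖v j • X j‖ := norm_sum_le _ _
      _ ≤ ∑ _j : Fin q, ‖v‖ * (1 / (q + 1)) := by
        refine Finset.sum_le_sum fun j _ => ?_
        rw [norm_smul]
        exact mul_le_mul (PiLp.norm_apply_le v j) ((norm_le_pi_norm X j).trans hX)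
          (norm_nonneg _) (norm_nonneg _)
      _ = ‖v‖ * (q / (q + 1)) := by
        rw [Finset.sum_const, Finset.card_univ, Fintype.card_fin, nsmul_eq_mul]; ring
      _ ≤ ‖v‖ := by
        refine mul_le_of_le_one_right (norm_nonneg _) ?_
        rw [div_le_one (by positivity)]; linarith
  exact ((Metric.measure_closedBall_pos volume _ (by positivity)).trans_le
    (measure_mono hsub)).ne'

lemma norm_tupleMap_sub_le_of_smul {p q : ℕ} {r : ℝ} (hr : 0 ≤ r)
    {X Y D₁ D₂ : Fin q → EuclideanSpace ℝ (Fin p)} (h₁ : D₁ ∈ r • opBall p q)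
    (h₂ : D₂ ∈ r • opBall p q) (h : X - Y = D₁ - D₂) (v : EuclideanSpace ℝ (Fin q)) :
    ‖tupleMap (X - Y) v‖ ≤ 2 * r * ‖v‖ := by
  obtain ⟨Z₁, hZ₁, rfl⟩ := h₁
  obtain ⟨Z₂, hZ₂, rfl⟩ := h₂
  change X - Y = r • Z₁ - r • Z₂ at h
  rw [h, ← smul_sub, tupleMap_smul, norm_smul, Real.norm_of_nonneg hr]
  nlinarith [opBall_sub_mem hZ₁ hZ₂ v]

/-- A net of the operator norm unit ball. -/
lemma exists_net_opBall (p q : ℕ) {θ : ℝ} (hθ : 0 < θ) (hθ1 : θ ≤ 1) :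
    ∃ s : Finset (Fin q → EuclideanSpace ℝ (Fin p)),
      (s.card : ENNReal) ≤ ENNReal.ofReal (3 / θ) ^ (p * q) ∧
      ∀ X ∈ opBall p q, ∃ Y ∈ s, ∀ v, ‖tupleMap (X - Y) v‖ ≤ θ * ‖v‖ := by
  have ht := volume_opBall_ne_top p q
  have h0 := volume_opBall_ne_zero p q
  have hD := volume_smul_tuple (p := p) (q := q) (r := θ / 2) (by positivity) (opBall p q)
  have hC := volume_smul_tuple (p := p) (q := q) (r := 3 / 2) (by positivity) (opBall p q)
  have hr0 : ENNReal.ofReal (θ / 2) ^ (p * q) ≠ 0 :=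
    pow_ne_zero _ (ENNReal.ofReal_pos.2 (by positivity)).ne'
  have hrt : ENNReal.ofReal (θ / 2) ^ (p * q) ≠ ⊤ := ENNReal.pow_ne_top ENNReal.ofReal_ne_top
  obtain ⟨s, -, hcard, hnet⟩ := exists_net_of_measure
    (volume : Measure (Fin q → EuclideanSpace ℝ (Fin p))) (K := opBall p q)
    (D := (θ / 2) • opBall p q) (C := (3 / 2 : ℝ) • opBall p q)
    ((isClosed_opBall p q).smul₀ (θ / 2)).measurableSet
    (by rw [hD]; exact mul_ne_zero hr0 h0)
    (by rw [hC]; exact ENNReal.mul_ne_top (ENNReal.pow_ne_top ENNReal.ofReal_ne_top) ht)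
    (by
      rintro X hX _ ⟨Y, hY, rfl⟩
      refine ⟨(3 / 2 : ℝ)⁻¹ • (X + (θ / 2) • Y), fun v => ?_, smul_inv_smul₀ (by norm_num) _⟩
      rw [tupleMap_smul, norm_smul, norm_inv, Real.norm_of_nonneg (by norm_num),
        inv_mul_le_iff₀ (by norm_num), tupleMap_add, tupleMap_smul]
      have h1 := norm_add_le (tupleMap X v) ((θ / 2) • tupleMap Y v)
      rw [norm_smul, Real.norm_of_nonneg (by positivity)] at h1
      have h2 := hX v
      have h3 : θ / 2 * ‖tupleMap Y v‖ ≤ 1 / 2 * ‖v‖ := by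
        gcongr
        exact hY v
      linarith)
  refine ⟨s, ?_, ?_⟩
  · rw [hD, hC, ← mul_assoc, ENNReal.mul_le_mul_iff_left h0 ht] at hcard
    have h3 : ENNReal.ofReal (3 / 2) = ENNReal.ofReal (3 / θ) * ENNReal.ofReal (θ / 2) := by
      rw [← ENNReal.ofReal_mul (by positivity)]
      congr 1
      field_simp
    rwa [h3, mul_pow, ENNReal.mul_le_mul_iff_left hr0 hrt] at hcard
  · intro X hX
    obtain ⟨Y, hY, D₁, h₁, D₂, h₂, h⟩ := hnet X hX
    refine ⟨Y, hY, fun v => ?_⟩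
    have := norm_tupleMap_sub_le_of_smul (by positivity) h₁ h₂ h v
    linarith

/-- An ellipsoid in `B` whose volume is comparable to the maximal one. -/
lemma exists_ellipsoid {N : ℕ} (hN : 0 < N) {B : Set (EuclideanSpace ℝ (Fin N))}
    (hBc : IsCompact B) {a ρ : ℝ} (ha : 0 < a) (haB : ∀ z, ‖z‖ ≤ a → z ∈ B) (hρ : 1 ≤ ρ)
    (hvr : volumeRatio B ≤ ρ) :
    ∃ A : EuclideanSpace ℝ (Fin N) ≃ₗ[ℝ] EuclideanSpace ℝ (Fin N),
      (∀ y, ‖y‖ ≤ 1 → A y ∈ B) ∧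
      volume (A ⁻¹' B) ≤ ENNReal.ofReal (2 * ρ) ^ N * ballVol N := by
  set vols := {v : ℝ | ∃ S : Set (EuclideanSpace ℝ (Fin N)),
      IsEllipsoid S ∧ S ⊆ B ∧ v = volume.real S} with hvols
  have hBt : volume B ≠ ⊤ := hBc.measure_lt_top.ne
  have hbdd : BddAbove vols := by
    refine ⟨volume.real B, ?_⟩
    rintro v ⟨S, -, hS, rfl⟩
    exact measureReal_mono hS hBt
  have hmem : volume.real (Metric.closedBall (0 : EuclideanSpace ℝ (Fin N)) a) ∈ vols := by
    refine ⟨_, ⟨LinearEquiv.smulOfUnit (Units.mk0 a ha.ne'), ?_⟩,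
      fun z hz => haB z (mem_closedBall_zero_iff.1 hz), rfl⟩
    have : (⇑(LinearEquiv.smulOfUnit (M := EuclideanSpace ℝ (Fin N)) (Units.mk0 a ha.ne')) ''
        Metric.closedBall 0 1) = a • Metric.closedBall (0 : EuclideanSpace ℝ (Fin N)) 1 := rfl
    rw [this, smul_unitClosedBall_of_nonneg ha.le]
  have hballpos : 0 < volume.real (Metric.closedBall (0 : EuclideanSpace ℝ (Fin N)) a) :=
    ENNReal.toReal_pos (Metric.measure_closedBall_pos volume _ ha).ne'
      (isCompact_closedBall _ _).measure_lt_top.ne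
  have hspos : 0 < sSup vols := hballpos.trans_le (le_csSup hbdd hmem)
  -- Attainment of the supremum is not needed: half of it suffices, and the lost factor 2 is
  -- absorbed into 2^N.
  obtain ⟨v, ⟨S, ⟨A, rfl⟩, hSB, rfl⟩, hv⟩ :=
    exists_lt_of_lt_csSup ⟨_, hmem⟩ (half_lt_self hspos)
  refine ⟨A, fun y hy => hSB ⟨y, mem_closedBall_zero_iff.2 hy, rfl⟩, ?_⟩
  unfold volumeRatio at hvr
  rw [← hvols, one_div, Real.rpow_inv_le_iff_of_pos (by positivity) (by linarith)
    (by exact_mod_cast hN), Real.rpow_natCast, div_le_iff₀ hspos] at hvr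
  have h1 : volume.real B ≤ (2 * ρ) ^ N * volume.real (A '' Metric.closedBall 0 1) := by
    calc volume.real B ≤ ρ ^ N * sSup vols := hvr
      _ ≤ ρ ^ N * (2 * volume.real (A '' Metric.closedBall 0 1)) := by gcongr; linarith
      _ = (2 * ρ ^ N) * volume.real (A '' Metric.closedBall 0 1) := by ring
      _ ≤ (2 * ρ) ^ N * volume.real (A '' Metric.closedBall 0 1) := by
        rw [mul_pow]
        gcongr
        exact le_self_pow₀ (by norm_num) hN.ne'
  have hSt : volume (A '' Metric.closedBall 0 1) ≠ ⊤ := ne_top_of_le_ne_top hBt (measure_mono hSB)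
  have h2 : volume B ≤ ENNReal.ofReal (2 * ρ) ^ N * volume (A '' Metric.closedBall 0 1) := by
    rw [← ENNReal.ofReal_toReal hBt, ← ENNReal.ofReal_toReal hSt,
      ← ENNReal.ofReal_pow (by positivity), ← ENNReal.ofReal_mul (by positivity)]
    exact ENNReal.ofReal_le_ofReal h1
  have himg := fun s => Measure.addHaar_image_linearMap
    (volume : Measure (EuclideanSpace ℝ (Fin N))) (A : _ →ₗ[ℝ] EuclideanSpace ℝ (Fin N)) s
  have hB2 : B = (A : _ →ₗ[ℝ] EuclideanSpace ℝ (Fin N)) '' (A ⁻¹' B) :=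
    (Set.image_preimage_eq B A.surjective).symm
  have hdet : ENNReal.ofReal |LinearMap.det (A : _ →ₗ[ℝ] EuclideanSpace ℝ (Fin N))| ≠ 0 := by
    refine (ENNReal.ofReal_pos.2 (abs_pos.2 ?_)).ne'
    exact (LinearEquiv.isUnit_det' A).ne_zero
  have h3 := himg (Metric.closedBall 0 1)
  have h4 := himg (A ⁻¹' B)
  rw [← hB2] at h4
  change volume (A '' Metric.closedBall 0 1) = _ * ballVol N at h3
  rw [h4, h3, ← mul_assoc, mul_comm (_ ^ N), mul_assoc,
    ENNReal.mul_le_mul_iff_right hdet ENNReal.ofReal_ne_top] at h2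
  exact h2

/-- A net of the operators from `ℓ_1` to the space with unit ball `B`, with respect to the
operators from the Euclidean space to the space with unit ball the ellipsoid of `A`. -/
lemma exists_net_tuples {N q : ℕ} (hq : 0 < q) (hqN : q ≤ N)
    {B : Set (EuclideanSpace ℝ (Fin N))} (hBconv : Convex ℝ B)
    (A : EuclideanSpace ℝ (Fin N) ≃ₗ[ℝ] EuclideanSpace ℝ (Fin N))
    (hA : ∀ y, ‖y‖ ≤ 1 → A y ∈ B) {ρ τ : ℝ} (hρ : 1 ≤ ρ) (hτ : 0 < τ)
    (hvol : volume (A ⁻¹' B) ≤ ENNReal.ofReal (2 * ρ) ^ N * ballVol N) :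
    ∃ s : Finset (Fin q → EuclideanSpace ℝ (Fin N)),
      (s.card : ENNReal) ≤ ENNReal.ofReal (256 * ρ) ^ (N * q) ∧
      ∀ X : Fin q → EuclideanSpace ℝ (Fin N), (∀ i, A (X i) ∈ τ • B) →
        ∃ Y ∈ s, ∀ v, ‖tupleMap (X - Y) v‖ ≤ τ * ‖v‖ := by
  have ht := volume_opBall_ne_top N q
  have h0 := volume_opBall_ne_zero N q
  have hD := volume_smul_tuple (p := N) (q := q) (r := τ / 2) (by positivity) (opBall N q)
  have hr0 : ENNReal.ofReal (τ / 2) ^ (N * q) ≠ 0 :=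
    pow_ne_zero _ (ENNReal.ofReal_pos.2 (by positivity)).ne'
  have hrt : ENNReal.ofReal (τ / 2) ^ (N * q) ≠ ⊤ := ENNReal.pow_ne_top ENNReal.ofReal_ne_top
  have hC : volume (Set.univ.pi fun _ : Fin q => (2 * τ) • (A ⁻¹' B)) ≤
      ENNReal.ofReal (256 * ρ) ^ (N * q) *
        (ENNReal.ofReal (τ / 2) ^ (N * q) * volume (opBall N q)) := by
    rw [volume_pi_set]
    simp only [volume_smul_set (by positivity : (0 : ℝ) ≤ 2 * τ), Finset.prod_const,
      Finset.card_univ, Fintype.card_fin]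
    -- The constant comes from (2τ)(2ρ) · 32 = 256ρ · (τ/2).
    calc (ENNReal.ofReal (2 * τ) ^ N * volume (A ⁻¹' B)) ^ q
        ≤ (ENNReal.ofReal (2 * τ) ^ N * (ENNReal.ofReal (2 * ρ) ^ N * ballVol N)) ^ q := by
          gcongr
      _ = ENNReal.ofReal (2 * τ) ^ (N * q) * ENNReal.ofReal (2 * ρ) ^ (N * q) *
          ballVol N ^ q := by
          rw [mul_pow, mul_pow, ← pow_mul, ← pow_mul, mul_assoc]
      _ ≤ ENNReal.ofReal (2 * τ) ^ (N * q) * ENNReal.ofReal (2 * ρ) ^ (N * q) *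
          (32 ^ (N * q) * volume (opBall N q)) := by
          gcongr
          exact ballVol_pow_le_volume_opBall hq hqN
      _ = _ := by
          rw [← mul_assoc, ← mul_assoc, ← mul_pow, ← mul_pow, ← mul_pow,
            ← ENNReal.ofReal_mul (by positivity), ← ENNReal.ofReal_mul (by positivity),
            ← ENNReal.ofReal_ofNat, ← ENNReal.ofReal_mul (by positivity)]
          congr 3
          ring
  obtain ⟨s, -, hcard, hnet⟩ := exists_net_of_measure
    (volume : Measure (Fin q → EuclideanSpace ℝ (Fin N)))
    (K := {X | ∀ i, A (X i) ∈ τ • B}) (D := (τ / 2) • opBall N q)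
    (C := Set.univ.pi fun _ : Fin q => (2 * τ) • (A ⁻¹' B))
    ((isClosed_opBall N q).smul₀ (τ / 2)).measurableSet
    (by rw [hD]; exact mul_ne_zero hr0 h0)
    (ne_top_of_le_ne_top (ENNReal.mul_ne_top (ENNReal.pow_ne_top ENNReal.ofReal_ne_top)
      (ENNReal.mul_ne_top hrt ht)) hC)
    (by
      rintro X hX _ ⟨Y, hY, rfl⟩ i -
      obtain ⟨b, hb, hbX⟩ := hX i
      have hXi : X i = τ • A.symm b := by
        apply A.injective
        rw [map_smul, A.apply_symm_apply]
        exact hbX.symm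
      have hYi := hA _ (norm_le_one_of_mem_opBall hY i)
      have h00 : (0 : EuclideanSpace ℝ (Fin N)) ∈ B := by
        have := hA 0 (by simp)
        rwa [map_zero] at this
      -- Divided by 2τ, the vector X i + (τ/2) Y i is the combination of A⁻¹b, Y i and 0 with
      -- weights 1/2, 1/4, 1/4, all three being points of A⁻¹B.
      refine ⟨(1 / 2 : ℝ) • A.symm b + (1 / 4 : ℝ) • Y i, ?_, ?_⟩
      · change A _ ∈ B
        rw [map_add, map_smul, map_smul, A.apply_symm_apply]
        have h1 := hBconv hYi h00 (by norm_num : (0 : ℝ) ≤ 1 / 2) (by norm_num : (0 : ℝ) ≤ 1 / 2)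
          (by norm_num)
        have h2 := hBconv hb h1 (by norm_num : (0 : ℝ) ≤ 1 / 2) (by norm_num : (0 : ℝ) ≤ 1 / 2)
          (by norm_num)
        convert h2 using 2
        rw [smul_zero, add_zero, smul_smul]
        norm_num
      · change (2 * τ) • _ = X i + (τ / 2) • Y i
        rw [hXi, smul_add, smul_smul, smul_smul]
        congr 2 <;> ring)
  refine ⟨s, ?_, ?_⟩
  · rw [hD] at hcard
    exact (ENNReal.mul_le_mul_iff_left (mul_ne_zero hr0 h0) (ENNReal.mul_ne_top hrt ht)).1
      (hcard.trans hC)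
  · intro X hX
    obtain ⟨Y, hY, D₁, h₁, D₂, h₂, h⟩ := hnet X hX
    refine ⟨Y, hY, fun v => ?_⟩
    have := norm_tupleMap_sub_le_of_smul (by positivity) h₁ h₂ h v
    linarith

lemma tupleMap_linearMap {p q : ℕ}
    (f : EuclideanSpace ℝ (Fin q) →ₗ[ℝ] EuclideanSpace ℝ (Fin p)) :
    tupleMap (fun j => f (EuclideanSpace.single j 1)) = f := by
  ext v : 1
  rw [tupleMap_comp]
  congr 1
  ext i
  simp [tupleMap_apply, Pi.single_apply]

/-- Every subspace of dimension at most `d` is the image of a contraction from `ℝ^d` which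
preserves the norm of suitable preimages. -/
lemma exists_tuple_of_finrank_le {n d : ℕ} (L : Submodule ℝ (EuclideanSpace ℝ (Fin n)))
    (hL : Module.finrank ℝ L ≤ d) :
    ∃ U ∈ opBall n d, ∀ l ∈ L, ∃ v, ‖v‖ = ‖l‖ ∧ tupleMap U v = l := by
  -- The e surplus coordinates are sent to 0, so a single d serves every smaller dimension.
  obtain ⟨e, rfl⟩ := Nat.exists_eq_add_of_le hL
  obtain ⟨ι, hι⟩ := exists_linearIsometry_mem L le_rfl
  have hrange : ι.toLinearMap.range = L := by
    refine Submodule.eq_of_le_of_finrank_eq ?_ ?_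
    · rintro _ ⟨u, rfl⟩; exact hι u
    · rw [LinearMap.finrank_range_of_inj ι.injective, finrank_euclideanSpace_fin]
  refine ⟨fun j => (ι.toLinearMap ∘ₗ headProj _ e) (EuclideanSpace.single j 1), ?_, ?_⟩
  · intro v
    rw [tupleMap_linearMap]
    exact (ι.norm_map _).le.trans (norm_headProj_le v)
  · intro l hl
    rw [← hrange] at hl
    obtain ⟨u, rfl⟩ := hl
    refine ⟨headIncl _ e u, ?_, ?_⟩
    · rw [LinearIsometry.norm_map]; exact (ι.norm_map u).symm
    · rw [tupleMap_linearMap, LinearMap.comp_apply, headProj_headIncl]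

/-! ### From a mixing operator to an exceptional tuple -/

lemma finrank_add_finrank_le_inf {n : ℕ} (G H : Submodule ℝ (EuclideanSpace ℝ (Fin n))) :
    Module.finrank ℝ G + Module.finrank ℝ H ≤
      Module.finrank ℝ (G ⊓ H : Submodule ℝ (EuclideanSpace ℝ (Fin n))) + n := by
  have h1 := Submodule.finrank_sup_add_finrank_inf_eq G H
  have h2 := Submodule.finrank_le (G ⊔ H)
  rw [finrank_euclideanSpace_fin] at h2
  omega

lemma le_finrank_ker_add {n p : ℕ}
    (f : EuclideanSpace ℝ (Fin n) →ₗ[ℝ] EuclideanSpace ℝ (Fin p))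
    (W : Submodule ℝ (EuclideanSpace ℝ (Fin p))) (hf : ∀ x, f x ∈ W) :
    n ≤ Module.finrank ℝ f.ker + Module.finrank ℝ W := by
  have h1 := f.finrank_range_add_finrank_ker
  have h2 : Module.finrank ℝ f.range ≤ Module.finrank ℝ W := by
    refine Submodule.finrank_mono ?_
    rintro _ ⟨x, rfl⟩; exact hf x
  rw [finrank_euclideanSpace_fin] at h1
  omega

/-- Mixing passes from `T` to the first block of the approximating operator `S'`. -/
lemma exists_mixing_isometry {n m d k : ℕ} {X : Fin m → EuclideanSpace ℝ (Fin n)}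
    (hX : X ∈ opBall n m) (T : EuclideanSpace ℝ (Fin n) →ₗ[ℝ] EuclideanSpace ℝ (Fin n))
    (L G : Submodule ℝ (EuclideanSpace ℝ (Fin n))) (hL : Module.finrank ℝ L ≤ d)
    (hG : 2 * k + 2 * m + 2 * d ≤ Module.finrank ℝ G)
    (hmix : ∀ x ∈ G, ∀ g ∈ G, ‖x‖ ≤ 2 * ‖T x - g‖)
    (S S' : EuclideanSpace ℝ (Fin n) →ₗ[ℝ] EuclideanSpace ℝ (Fin (n + m)))
    (A : EuclideanSpace ℝ (Fin (n + m)) →ₗ[ℝ] EuclideanSpace ℝ (Fin (n + m)))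
    (Δ : EuclideanSpace ℝ (Fin n) →ₗ[ℝ] EuclideanSpace ℝ (Fin (n + m)))
    (hS : ∀ x, S x = S' x + A (Δ x)) (hTS : ∀ x, T x - quotMap X (S x) ∈ L)
    (M : Submodule ℝ (EuclideanSpace ℝ (Fin (n + m)))) (hM : n + m ≤ Module.finrank ℝ M + k)
    {V τ : ℝ} (hV : 0 ≤ V) (hA : ∀ y ∈ M, ‖A y‖ ≤ 2 * V * ‖y‖)
    (hΔ : ∀ x, ‖Δ x‖ ≤ τ * ‖x‖) (hτV : 16 * τ * V ≤ 1) :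
    ∃ φ : EuclideanSpace ℝ (Fin (k + m + d)) →ₗᵢ[ℝ] EuclideanSpace ℝ (Fin n),
      ∀ u v, ‖u‖ ≤ 4 * ‖headProj n m (S' (φ u)) - φ v‖ := by
  -- On H₁ the lift is exact, on H₂ the error Δx lies in M where A is small, and on H₃ the second
  -- block of S'x vanishes, so X no longer acts on it. The codimensions are at most d, k and m,
  -- which leaves k + m + d dimensions of G.
  set H₁ := (T - quotMap X ∘ₗ S).ker
  set H₂ := ((Mᗮ.starProjection :
    EuclideanSpace ℝ (Fin (n + m)) →ₗ[ℝ] EuclideanSpace ℝ (Fin (n + m))) ∘ₗ Δ).ker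
  set H₃ := (tailProj n m ∘ₗ S').ker
  have h₁ : n ≤ Module.finrank ℝ H₁ + Module.finrank ℝ L := le_finrank_ker_add _ L hTS
  have h₂ : n ≤ Module.finrank ℝ H₂ + Module.finrank ℝ Mᗮ :=
    le_finrank_ker_add _ _ fun x => Submodule.starProjection_apply_mem _ _
  have h₃ : n ≤ Module.finrank ℝ H₃ + m := by
    have := le_finrank_ker_add (tailProj n m ∘ₗ S') ⊤ fun _ => Submodule.mem_top
    rwa [finrank_top, finrank_euclideanSpace_fin] at this
  have hMo := Submodule.finrank_add_finrank_orthogonal M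
  rw [finrank_euclideanSpace_fin] at hMo
  have hi₁ := finrank_add_finrank_le_inf G H₁
  have hi₂ := finrank_add_finrank_le_inf (G ⊓ H₁) H₂
  have hi₃ := finrank_add_finrank_le_inf (G ⊓ H₁ ⊓ H₂) H₃
  obtain ⟨φ, hφ⟩ := exists_linearIsometry_mem (k := k + m + d) (G ⊓ H₁ ⊓ H₂ ⊓ H₃) (by omega)
  refine ⟨φ, fun u v => ?_⟩
  obtain ⟨⟨⟨hxG, hx₁⟩, hx₂⟩, hx₃⟩ := hφ u
  have hgG : φ v ∈ G := (hφ v).1.1.1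
  set x := φ u with hx
  have e₁ : T x = quotMap X (S x) := sub_eq_zero.1 hx₁
  have e₂ : Δ x ∈ M := by
    have : Mᗮ.starProjection (Δ x) = 0 := hx₂
    have h := Mᗮ.starProjection_apply_eq_zero_iff.1 this
    rwa [Submodule.orthogonal_orthogonal] at h
  have e₃ : tailProj n m (S' x) = 0 := hx₃
  have e₄ : headProj n m (S' x) = T x - quotMap X (A (Δ x)) := by
    rw [e₁, hS, map_add, add_sub_cancel_right, quotMap_apply, e₃, map_zero, add_zero]
  -- An error of ‖x‖/4 turns the mixing constant 2 into 4.
  have h5 : ‖quotMap X (A (Δ x))‖ ≤ ‖x‖ / 4 := by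
    calc ‖quotMap X (A (Δ x))‖ ≤ 2 * ‖A (Δ x)‖ := norm_quotMap_le hX _
      _ ≤ 2 * (2 * V * (τ * ‖x‖)) := by
        gcongr
        exact (hA _ e₂).trans (by gcongr; exact hΔ x)
      _ = 16 * τ * V * (‖x‖ / 4) := by ring
      _ ≤ 1 * (‖x‖ / 4) := by gcongr
      _ = ‖x‖ / 4 := one_mul _
  have h6 := hmix x hxG _ hgG
  have h7 : T x - φ v = (headProj n m (S' x) - φ v) + quotMap X (A (Δ x)) := by rw [e₄]; abel
  have h8 := norm_add_le (headProj n m (S' x) - φ v) (quotMap X (A (Δ x)))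
  rw [← h7] at h8
  rw [← φ.norm_map u]
  linarith

/-- Composition with a contraction does not increase the Hilbert–Schmidt norm; the transpose of X is
applied to each row of y. -/
lemma sum_norm_sq_tupleMap_le {n m N : ℕ} {X : Fin m → EuclideanSpace ℝ (Fin n)}
    (hX : X ∈ opBall n m) (y : Fin n → EuclideanSpace ℝ (Fin N)) :
    ∑ j, ‖tupleMap y (X j)‖ ^ 2 ≤ ∑ i, ‖y i‖ ^ 2 := by
  let row : Fin N → EuclideanSpace ℝ (Fin n) := fun r => WithLp.toLp 2 fun i => y i r
  have h1 : ∀ j r, tupleMap y (X j) r = inner ℝ (X j) (row r) := by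
    intro j r
    simp [tupleMap_apply, PiLp.inner_apply, row, mul_comm]
  have h2 : ∑ i, ‖y i‖ ^ 2 = ∑ r, ‖row r‖ ^ 2 := by
    simp only [EuclideanSpace.norm_sq_eq, row]
    exact Finset.sum_comm
  rw [h2]
  simp only [EuclideanSpace.norm_sq_eq (tupleMap y _), h1, Real.norm_eq_abs, sq_abs]
  rw [Finset.sum_comm]
  exact Finset.sum_le_sum fun r _ => sum_inner_sq_le_of_mem_opBall hX (row r)

-- Markov's inequality for the Hilbert–Schmidt norm: at most nε²/4 ≤ m/4 columns exceed 2/ε. The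
-- remaining count is at least m/2 rounded up, so no half is lost when m is odd.
open Classical in
lemma card_filter_norm_tupleMap_le {n m N : ℕ} {X : Fin m → EuclideanSpace ℝ (Fin n)}
    (hX : X ∈ opBall n m) (y : Fin n → EuclideanSpace ℝ (Fin N)) (hy : ∀ i, ‖y i‖ ≤ 1)
    {ε : ℝ} (hε : 0 < ε) (hε1 : ε ≤ 1) (hm : (m : ℝ) = ε * n) :
    (m + 1) / 2 ≤ (Finset.univ.filter fun j => ‖tupleMap y (X j)‖ ≤ 2 / ε).card := by
  set J := Finset.univ.filter fun j => ‖tupleMap y (X j)‖ ≤ 2 / ε with hJ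
  have h1 : (Jᶜ.card : ℝ) * (2 / ε) ^ 2 ≤ n := by
    calc (Jᶜ.card : ℝ) * (2 / ε) ^ 2 = ∑ _j ∈ Jᶜ, (2 / ε) ^ 2 := by
          rw [Finset.sum_const, nsmul_eq_mul]
      _ ≤ ∑ j ∈ Jᶜ, ‖tupleMap y (X j)‖ ^ 2 := by
          refine Finset.sum_le_sum fun j hj => ?_
          have : ¬ ‖tupleMap y (X j)‖ ≤ 2 / ε := by simpa [hJ] using hj
          gcongr
          exact (not_le.1 this).le
      _ ≤ ∑ j, ‖tupleMap y (X j)‖ ^ 2 :=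
          Finset.sum_le_univ_sum_of_nonneg fun _ => by positivity
      _ ≤ ∑ i, ‖y i‖ ^ 2 := sum_norm_sq_tupleMap_le hX y
      _ ≤ ∑ _i : Fin n, (1 : ℝ) :=
          Finset.sum_le_sum fun i _ => pow_le_one₀ (norm_nonneg _) (hy i)
      _ = n := by simp
  have h2 : (4 : ℝ) * Jᶜ.card ≤ m := by
    have h3 : (Jᶜ.card : ℝ) * 4 ≤ n * ε ^ 2 := by
      rw [div_pow, mul_div_assoc', div_le_iff₀ (by positivity)] at h1
      linarith
    have h4 : (n : ℝ) * ε ^ 2 ≤ m := by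
      rw [hm]
      have : (0 : ℝ) ≤ n := by positivity
      nlinarith [mul_nonneg this hε.le]
    linarith
  have h3 : 4 * Jᶜ.card ≤ m := by exact_mod_cast h2
  have h4 := Finset.card_add_card_compl J
  rw [Fintype.card_fin] at h4
  omega

/-- Both discretisation errors are absorbed into B. The bound on S(Xⱼ) for j ∈ J bounds the
component in L by 6τ/ε, so replacing U by U' moves it by at most τa, a vector of τB after inclusion
in the first block. The ellipsoid error A(Δ Xⱼ) also lies in τB. With the original τy this makes
three terms, hence 3τ. -/
lemma mem_badSet {n m d : ℕ} {B : Set (EuclideanSpace ℝ (Fin (n + m)))} (hBconv : Convex ℝ B)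
    (hBsymm : ∀ z ∈ B, -z ∈ B) (hB : B ⊆ Metric.closedBall 0 1) {a : ℝ}
    (ha : 0 < a) (haB : ∀ z, ‖z‖ ≤ a → z ∈ B)
    {X : Fin m → EuclideanSpace ℝ (Fin n)} (hX : X ∈ opBall n m)
    (L : Submodule ℝ (EuclideanSpace ℝ (Fin n)))
    (S S' : EuclideanSpace ℝ (Fin n) →ₗ[ℝ] EuclideanSpace ℝ (Fin (n + m)))
    (A : EuclideanSpace ℝ (Fin (n + m)) →ₗ[ℝ] EuclideanSpace ℝ (Fin (n + m)))
    (hA : ∀ y, ‖y‖ ≤ 1 → A y ∈ B)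
    (Δ : EuclideanSpace ℝ (Fin n) →ₗ[ℝ] EuclideanSpace ℝ (Fin (n + m)))
    (hS : ∀ x, S x = S' x + A (Δ x)) {τ ε : ℝ} (hτ : 0 < τ) (hε : 0 < ε) (hε1 : ε ≤ 1)
    (hΔ : ∀ x, ‖Δ x‖ ≤ τ * ‖x‖) (J : Finset (Fin m))
    (hJ : ∀ j ∈ J, ‖S (X j)‖ ≤ τ * (2 / ε))
    (hL : ∀ j, ∃ y ∈ B, quotMap X (S (X j)) - τ • quotMap X y ∈ L)
    (U U' : EuclideanSpace ℝ (Fin d) →ₗ[ℝ] EuclideanSpace ℝ (Fin n))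
    (hU : ∀ l ∈ L, ∃ v, ‖v‖ = ‖l‖ ∧ U v = l)
    (hUU' : ∀ v, ‖U v - U' v‖ ≤ a * ε / 6 * ‖v‖) :
    X ∈ badSet B S' U' J (3 * τ) (6 / ε * τ) := by
  refine ⟨hX, fun j hj => ?_⟩
  obtain ⟨y, hy, hl⟩ := hL j
  set l := quotMap X (S (X j)) - τ • quotMap X y with hldef
  obtain ⟨v, hvl, hv⟩ := hU l hl
  have hln : ‖l‖ ≤ 6 / ε * τ := by
    have h1 : l = quotMap X (S (X j) - τ • y) := by rw [map_sub, map_smul]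
    have h2 : ‖S (X j) - τ • y‖ ≤ τ * (2 / ε) + τ * 1 := by
      refine (norm_sub_le _ _).trans (add_le_add (hJ j hj) ?_)
      rw [norm_smul, Real.norm_of_nonneg hτ.le]
      gcongr
      exact mem_closedBall_zero_iff.1 (hB hy)
    have h3 : 1 ≤ 1 / ε := by rw [one_le_div hε]; exact hε1
    rw [h1]
    calc _ ≤ 2 * ‖S (X j) - τ • y‖ := norm_quotMap_le hX _
      _ ≤ 2 * (τ * (2 / ε) + τ * (1 / ε)) := by
        refine mul_le_mul_of_nonneg_left (h2.trans ?_) (by norm_num)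
        gcongr
      _ = 6 / ε * τ := by ring
  set p := headIncl n m (U v - U' v) with hp
  have hpB : τ⁻¹ • p ∈ B := by
    refine haB _ ?_
    rw [norm_smul, norm_inv, Real.norm_of_nonneg hτ.le, inv_mul_le_iff₀ hτ, hp,
      LinearIsometry.norm_map]
    calc _ ≤ a * ε / 6 * ‖v‖ := hUU' v
      _ ≤ a * ε / 6 * (6 / ε * τ) := by
        rw [hvl]
        gcongr
      _ = τ * a := by field_simp
  have hqB : A (τ⁻¹ • Δ (X j)) ∈ B := by
    refine hA _ ?_
    rw [norm_smul, norm_inv, Real.norm_of_nonneg hτ.le, inv_mul_le_iff₀ hτ]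
    exact (hΔ _).trans (mul_le_mul_of_nonneg_left (norm_le_one_of_mem_opBall hX j) hτ.le)
  refine ⟨((1 / 3 : ℝ) • (y + τ⁻¹ • p - A (τ⁻¹ • Δ (X j))), v), ⟨?_, ?_⟩, ?_⟩
  · have h1 := hBconv hy hpB (by norm_num : (0 : ℝ) ≤ 1 / 2) (by norm_num : (0 : ℝ) ≤ 1 / 2)
      (by norm_num)
    have h2 := hBconv h1 (hBsymm _ hqB) (by norm_num : (0 : ℝ) ≤ 2 / 3)
      (by norm_num : (0 : ℝ) ≤ 1 / 3) (by norm_num)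
    convert h2 using 1
    module
  · rw [mem_closedBall_zero_iff, hvl]; exact hln
  · have e1 : quotMap X (S (X j)) = l + τ • quotMap X y := by rw [hldef]; abel
    have e2 : quotMap X p = l - U' v := by rw [hp, quotMap_headIncl, hv]
    have e3 : quotMap X (S' (X j)) = quotMap X (S (X j)) - quotMap X (A (Δ (X j))) := by
      rw [hS, map_add, add_sub_cancel_right]
    change _ = (3 * τ) • quotMap X ((1 / 3 : ℝ) • _) + U' v
    rw [e3, e1]
    simp only [map_smul, map_add, map_sub, e2, smul_smul, smul_add, smul_sub]
    have h3 : 3 * τ * (1 / 3) = τ := by ring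
    have h4 : 3 * τ * (1 / 3 * τ⁻¹) = 1 := by field_simp
    rw [h3, h4]
    simp only [one_smul]
    abel

/-! ### The union bound -/

/-- Existence of a quotient map which is good for all mixing operators. -/
theorem exists_tuple_forall_mixing {n m d k : ℕ} (hk : 0 < k) (hm : 0 < m) (hmn : m ≤ n)
    {B : Set (EuclideanSpace ℝ (Fin (n + m)))} (hBc : IsCompact B) (hBconv : Convex ℝ B)
    (hBsymm : ∀ z ∈ B, -z ∈ B) (hB : B ⊆ Metric.closedBall 0 1)
    {a ρ τ ε : ℝ} (ha : 0 < a) (ha1 : a ≤ 1) (haB : ∀ z, ‖z‖ ≤ a → z ∈ B) (hρ : 1 ≤ ρ)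
    (hvr : volumeRatio B ≤ ρ) (hτ : 0 < τ) (hε : 0 < ε) (hε1 : ε ≤ 1) (hmε : (m : ℝ) = ε * n)
    (hV : 0 < volumeNumber k B) (hτV : 16 * τ * volumeNumber k B ≤ 1)
    (hnum : (256 * ρ) ^ ((n + m) * n) * (18 / (a * ε)) ^ (n * d) * 2 ^ m *
      (12 * τ * volumeNumber k B) ^ (k * ((m + 1) / 2)) * 128 ^ (n * m) < 1) :
    ∃ X ∈ opBall n m, ∀ (T : EuclideanSpace ℝ (Fin n) →ₗ[ℝ] EuclideanSpace ℝ (Fin n))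
      (L G : Submodule ℝ (EuclideanSpace ℝ (Fin n))), Module.finrank ℝ L ≤ d →
      2 * k + 2 * m + 2 * d ≤ Module.finrank ℝ G →
      (∀ x ∈ G, ∀ g ∈ G, ‖x‖ ≤ 2 * ‖T x - g‖) →
      ¬ ∀ i, ∃ y ∈ B, T (quotMap X (EuclideanSpace.single i 1)) - τ • quotMap X y ∈ L := by
  classical
  set V := volumeNumber k B with hVdef
  have hn : 0 < n := hm.trans_le hmn
  obtain ⟨A, hA, hAvol⟩ := exists_ellipsoid (by omega) hBc ha haB hρ hvr
  obtain ⟨M, hM, hAM⟩ := exists_submodule_norm_le hk hB hV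
    (A : EuclideanSpace ℝ (Fin (n + m)) →ₗ[ℝ] EuclideanSpace ℝ (Fin (n + m))) hA
  obtain ⟨sS, hsS, hnetS⟩ := exists_net_tuples hn (Nat.le_add_right n m) hBconv A hA hρ hτ hAvol
  have haε : a * ε ≤ 1 := mul_le_one₀ ha1 hε.le hε1
  have haε0 : 0 < a * ε := mul_pos ha hε
  obtain ⟨sU, hsU, hnetU⟩ := exists_net_opBall n d (θ := a * ε / 6) (by positivity) (by linarith)
  let op : (Fin n → EuclideanSpace ℝ (Fin (n + m))) →
      EuclideanSpace ℝ (Fin n) →ₗ[ℝ] EuclideanSpace ℝ (Fin (n + m)) := fun R =>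
    (A : EuclideanSpace ℝ (Fin (n + m)) →ₗ[ℝ] EuclideanSpace ℝ (Fin (n + m))) ∘ₗ tupleMap R
  let mixing : (Fin n → EuclideanSpace ℝ (Fin (n + m))) → Prop := fun R =>
    ∃ φ : EuclideanSpace ℝ (Fin (k + m + d)) →ₗᵢ[ℝ] EuclideanSpace ℝ (Fin n),
      ∀ u v, ‖u‖ ≤ 4 * ‖headProj n m (op R (φ u)) - φ v‖
  let bad : (Fin n → EuclideanSpace ℝ (Fin (n + m))) × (Fin d → EuclideanSpace ℝ (Fin n)) ×
      Finset (Fin m) → Set (Fin m → EuclideanSpace ℝ (Fin n)) := fun z =>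
    badSet B (op z.1) (tupleMap z.2.1) z.2.2 (3 * τ) (6 / ε * τ)
  -- Only net operators that are themselves mixing are kept, since the volume estimate applies to no
  -- others.
  let idx := (sS ×ˢ sU ×ˢ (Finset.univ : Finset (Finset (Fin m)))).filter fun z =>
    mixing z.1 ∧ (m + 1) / 2 ≤ z.2.2.card
  have hbad : ∀ z ∈ idx, volume (bad z) ≤
      ENNReal.ofReal (12 * τ * V) ^ (k * ((m + 1) / 2)) * 4 ^ (n * m) * ballVol n ^ m := by
    intro z hz
    obtain ⟨-, ⟨φ, hφ⟩, hJ⟩ := Finset.mem_filter.1 hz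
    refine (volume_badSet_le hk hBc hB (op z.1) (tupleMap z.2.1) z.2.2 (by positivity) _ φ hφ
      le_rfl).trans ?_
    have h1 : 4 * (3 * τ) * V = 12 * τ * V := by ring
    -- As the base is at most 1, additional columns in J only decrease the bound.
    have h2 : ENNReal.ofReal (12 * τ * V) ≤ 1 := by
      rw [ENNReal.ofReal_le_one]
      nlinarith [mul_pos hτ hV]
    rw [← hVdef, h1]
    gcongr ?_ * _ * _
    exact pow_le_pow_right_of_le_one' h2 (Nat.mul_le_mul_left k hJ)
  have hidx : (idx.card : ENNReal) ≤ ENNReal.ofReal (256 * ρ) ^ ((n + m) * n) *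
      ENNReal.ofReal (18 / (a * ε)) ^ (n * d) * 2 ^ m := by
    have h1 : idx.card ≤ sS.card * (sU.card * 2 ^ m) := by
      refine (Finset.card_filter_le _ _).trans (le_of_eq ?_)
      rw [Finset.card_product, Finset.card_product, Finset.card_univ, Fintype.card_finset,
        Fintype.card_fin]
    have h2 : (3 / (a * ε / 6) : ℝ) = 18 / (a * ε) := by field_simp; norm_num
    rw [h2] at hsU
    calc (idx.card : ENNReal) ≤ ((sS.card * (sU.card * 2 ^ m) : ℕ) : ENNReal) := by
          exact_mod_cast h1
      _ = sS.card * sU.card * 2 ^ m := by push_cast; ring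
      _ ≤ _ := by gcongr
  have hex : ∃ X ∈ opBall n m, ∀ z ∈ idx, X ∉ bad z := by
    by_contra hcon
    push Not at hcon
    have hsub : opBall n m ⊆ ⋃ z ∈ idx, bad z := by
      intro X hX
      obtain ⟨z, hz, hXz⟩ := hcon X hX
      exact Set.mem_biUnion hz hXz
    have h1 : volume (opBall n m) ≤ idx.card * (ENNReal.ofReal (12 * τ * V) ^
        (k * ((m + 1) / 2)) * 4 ^ (n * m) * ballVol n ^ m) := by
      refine (measure_mono hsub).trans ((measure_biUnion_finset_le _ _).trans ?_)
      refine (Finset.sum_le_sum hbad).trans (le_of_eq ?_)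
      rw [Finset.sum_const, nsmul_eq_mul]
    have h2 : ballVol n ^ m ≤ ENNReal.ofReal ((256 * ρ) ^ ((n + m) * n) *
        (18 / (a * ε)) ^ (n * d) * 2 ^ m * (12 * τ * V) ^ (k * ((m + 1) / 2)) *
        128 ^ (n * m)) * ballVol n ^ m := by
      calc ballVol n ^ m ≤ 32 ^ (n * m) * volume (opBall n m) :=
            ballVol_pow_le_volume_opBall hm hmn
        _ ≤ 32 ^ (n * m) * ((ENNReal.ofReal (256 * ρ) ^ ((n + m) * n) *
              ENNReal.ofReal (18 / (a * ε)) ^ (n * d) * 2 ^ m) *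
              (ENNReal.ofReal (12 * τ * V) ^ (k * ((m + 1) / 2)) * 4 ^ (n * m) *
                ballVol n ^ m)) := by
            refine mul_le_mul_right (h1.trans (mul_le_mul_left hidx _)) _
        _ = _ := by
            have hx : 0 ≤ 256 * ρ := by positivity
            have hy : 0 ≤ 18 / (a * ε) := by positivity
            have hz : 0 ≤ 12 * τ * V := by positivity
            generalize 256 * ρ = x at hx ⊢
            generalize 18 / (a * ε) = y at hy ⊢
            generalize 12 * τ * V = z at hz ⊢
            rw [ENNReal.ofReal_mul (by positivity), ENNReal.ofReal_mul (by positivity),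
              ENNReal.ofReal_mul (by positivity), ENNReal.ofReal_mul (by positivity),
              ENNReal.ofReal_pow hx, ENNReal.ofReal_pow hy, ENNReal.ofReal_pow hz,
              ENNReal.ofReal_pow (by positivity), ENNReal.ofReal_pow (by positivity),
              ENNReal.ofReal_ofNat, ENNReal.ofReal_ofNat]
            have h128 : (128 : ENNReal) = 32 * 4 := by norm_num
            rw [h128, mul_pow]
            ring
    have h3 : (1 : ENNReal) ≤ ENNReal.ofReal ((256 * ρ) ^ ((n + m) * n) *
        (18 / (a * ε)) ^ (n * d) * 2 ^ m * (12 * τ * V) ^ (k * ((m + 1) / 2)) *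
        128 ^ (n * m)) := by
      refine (ENNReal.mul_le_mul_iff_left (pow_ne_zero m (ballVol_ne_zero n))
        (ENNReal.pow_ne_top (ballVol_ne_top n))).1 ?_
      rwa [one_mul]
    rw [ENNReal.one_le_ofReal] at h3
    linarith
  obtain ⟨X, hX, hXbad⟩ := hex
  refine ⟨X, hX, fun T L G hL hG hmix hall => ?_⟩
  choose y hyB hy using hall
  -- The first n relations define the lift of T; the last m are kept as constraints on the columns
  -- of X.
  let y' : Fin n → EuclideanSpace ℝ (Fin (n + m)) := fun i => y (Fin.castAdd m i)
  let R : Fin n → EuclideanSpace ℝ (Fin (n + m)) := fun i => τ • A.symm (y' i)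
  have hAR : ∀ i, A (R i) = τ • y' i := by
    intro i
    rw [map_smul, A.apply_symm_apply]
  obtain ⟨R', hR', hRR'⟩ := hnetS R fun i => ⟨y' i, hyB _, (hAR i).symm⟩
  obtain ⟨U, hU, hUL⟩ := exists_tuple_of_finrank_le L hL
  obtain ⟨U', hU', hUU'⟩ := hnetU U hU
  have hS : ∀ x, op R x = op R' x + A (tupleMap (R - R') x) := by
    intro x
    rw [tupleMap_sub, map_sub]
    change A _ = A _ + _
    abel
  have hSy : ∀ x, op R x = τ • tupleMap y' x := by
    intro x
    change A (tupleMap R x) = _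
    rw [← tupleMap_smul]
    have h1 : τ • y' = fun j => (A : EuclideanSpace ℝ (Fin (n + m)) →ₗ[ℝ]
      EuclideanSpace ℝ (Fin (n + m))) (R j) := by
      funext i
      exact (hAR i).symm
    rw [h1, tupleMap_comp]
    rfl
  have hTS : ∀ x, T x - quotMap X (op R x) ∈ L := by
    intro x
    have h1 : T x - quotMap X (op R x) = (T - quotMap X ∘ₗ op R) x := rfl
    rw [h1, ← tupleMap_linearMap (T - quotMap X ∘ₗ op R), tupleMap_apply]
    refine L.sum_mem fun i _ => L.smul_mem _ ?_
    have h2 := hy (Fin.castAdd m i)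
    rw [quotMap_single_castAdd] at h2
    change T _ - quotMap X (op R _) ∈ L
    rw [hSy, tupleMap_single, map_smul]
    exact h2
  have hmixing : mixing R' := exists_mixing_isometry hX T L G hL hG hmix (op R) (op R') A
    (tupleMap (R - R')) hS hTS M hM hV.le hAM hRR' hτV
  let J : Finset (Fin m) := Finset.univ.filter fun j => ‖tupleMap y' (X j)‖ ≤ 2 / ε
  have hJ : (m + 1) / 2 ≤ J.card :=
    card_filter_norm_tupleMap_le hX y' (fun i => mem_closedBall_zero_iff.1 (hB (hyB _))) hε hε1 hmε
  refine hXbad (R', U', J) (Finset.mem_filter.2 ⟨?_, hmixing, hJ⟩) ?_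
  · exact Finset.mk_mem_product hR' (Finset.mk_mem_product hU' (Finset.mem_univ _))
  · refine mem_badSet hBconv hBsymm hB ha haB hX L (op R) (op R') A hA (tupleMap (R - R')) hS hτ
      hε hε1 hRR' J ?_ ?_ (tupleMap U) (tupleMap U') hUL ?_
    · intro j hj
      rw [hSy, norm_smul, Real.norm_of_nonneg hτ.le]
      exact mul_le_mul_of_nonneg_left (Finset.mem_filter.1 hj).2 hτ.le
    · intro j
      refine ⟨y (Fin.natAdd n j), hyB _, ?_⟩
      have h1 := hy (Fin.natAdd n j)
      rw [quotMap_single_natAdd] at h1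
      -- Subtracting two expressions for T(Xⱼ) modulo L eliminates T.
      have h2 := L.sub_mem h1 (hTS (X j))
      have h3 : T (X j) - τ • quotMap X (y (Fin.natAdd n j)) - (T (X j) - quotMap X (op R (X j))) =
          quotMap X (op R (X j)) - τ • quotMap X (y (Fin.natAdd n j)) := by abel
      rwa [h3] at h2
    · intro v
      rw [← tupleMap_sub]
      exact hUU' v

/-- The numerical inequality behind the union bound. -/
lemma union_bound_lt_one {ε η ρ a δ b : ℝ} (hη : 0 < η) (hη1 : η ≤ 1) (hε : 0 < ε) (hε1 : ε ≤ 1)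
    (hρ : 1 ≤ ρ) (ha : 0 < a) (ha1 : a ≤ 1) (hδ : 0 < δ) (hδ1 : δ ≤ 1)
    (hb : b = (1 / (2 * ((256 * ρ) ^ 2 * (18 / ε) * 256))) ^ (8 / (η * ε)))
    {n m d k : ℕ} (hn : 0 < n) (hmn : m ≤ n) (hm : (m : ℝ) = ε * n)
    (hk : η * n / 4 ≤ k) (hd : (d : ℝ) ≤ δ * ε * η / 2 ^ 5 * n) :
    (256 * ρ) ^ ((n + m) * n) * (18 / (a * ε)) ^ (n * d) * 2 ^ m *
      (b * a ^ δ) ^ (k * ((m + 1) / 2)) * 128 ^ (n * m) < 1 := by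
  set M := (256 * ρ) ^ 2 * (18 / ε) * 256 with hM
  have h18 : 1 ≤ 18 / ε := by rw [one_le_div hε]; linarith
  have h256 : 1 ≤ 256 * ρ := by linarith
  have hM1 : 1 ≤ M := by
    have : 1 ≤ (256 * ρ) ^ 2 := one_le_pow₀ h256
    calc (1 : ℝ) = 1 * 1 * 1 := by norm_num
      _ ≤ M := by rw [hM]; gcongr; norm_num
  have hM0 : 0 < M := by linarith
  have hn0 : (0 : ℝ) < n := by exact_mod_cast hn
  have hb0 : 0 < b := by rw [hb]; positivity
  have hb1 : b ≤ 1 := by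
    rw [hb]
    refine Real.rpow_le_one (by positivity) ?_ (by positivity)
    rw [div_le_one (by positivity)]
    linarith
  have haδ0 : 0 < a ^ δ := Real.rpow_pos_of_pos ha δ
  have haδ1 : a ^ δ ≤ 1 := Real.rpow_le_one ha.le ha1 hδ.le
  have hba1 : b * a ^ δ ≤ 1 := mul_le_one₀ hb1 haδ0.le haδ1
  -- This s bounds the exponent k⌈m/2⌉ from below. The power in b is chosen so that b^s =
  -- (2M)^(-n²), where M^(n²) dominates all factors free of a.
  set s := η * ε * (n : ℝ) ^ 2 / 8 with hs
  have hkm : s ≤ ((k * ((m + 1) / 2) : ℕ) : ℝ) := by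
    have h1 : (m : ℝ) / 2 ≤ (((m + 1) / 2 : ℕ) : ℝ) := by
      have : m ≤ 2 * ((m + 1) / 2) := by omega
      have : (m : ℝ) ≤ 2 * (((m + 1) / 2 : ℕ) : ℝ) := by exact_mod_cast this
      linarith
    push_cast
    calc s = (η * n / 4) * ((m : ℝ) / 2) := by rw [hs, hm]; ring
      _ ≤ _ := by
        have := mul_le_mul hk h1 (by positivity) (by positivity)
        exact_mod_cast this
  have hP : (b * a ^ δ) ^ (k * ((m + 1) / 2)) ≤ (1 / (2 * M)) ^ (n ^ 2) * a ^ (δ * s) := by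
    calc (b * a ^ δ) ^ (k * ((m + 1) / 2)) = (b * a ^ δ) ^ ((k * ((m + 1) / 2) : ℕ) : ℝ) :=
          (Real.rpow_natCast _ _).symm
      _ ≤ (b * a ^ δ) ^ s := Real.rpow_le_rpow_of_exponent_ge (by positivity) hba1 hkm
      _ = (1 / (2 * M)) ^ (n ^ 2) * a ^ (δ * s) := by
        rw [Real.mul_rpow hb0.le haδ0.le, ← Real.rpow_mul ha.le, hb, ← Real.rpow_mul (by positivity)]
        congr 1
        rw [← Real.rpow_natCast]
        congr 1
        rw [hs]
        push_cast
        field_simp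
  -- The net for L costs a^(-nd), and nd ≤ δεηn²/32 ≤ δs, so the gain a^(δs) pays for it.
  have hQ : (18 / (a * ε)) ^ (n * d) ≤ (18 / ε) ^ (n ^ 2) * a ^ (-(δ * s)) := by
    have h1 : (18 / (a * ε)) ^ (n * d) = (18 / ε) ^ (n * d) * a ^ (-((n * d : ℕ) : ℝ)) := by
      rw [Real.rpow_neg ha.le, Real.rpow_natCast, ← inv_pow, ← mul_pow]
      congr 1
      field_simp
    have hd2 : (d : ℝ) ≤ n := by
      refine hd.trans ?_
      have h2 : δ * ε * η ≤ 1 := mul_le_one₀ (mul_le_one₀ hδ1 hε.le hε1) hη.le hη1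
      have h3 : δ * ε * η / 2 ^ 5 ≤ 1 := by
        rw [div_le_one (by positivity)]; linarith
      exact mul_le_of_le_one_left hn0.le h3
    have hdn : d ≤ n := by exact_mod_cast hd2
    rw [h1]
    refine mul_le_mul (pow_le_pow_right₀ h18 ?_) ?_ (by positivity) (by positivity)
    · rw [sq]; exact Nat.mul_le_mul_left n hdn
    · refine Real.rpow_le_rpow_of_exponent_ge ha ha1 ?_
      rw [neg_le_neg_iff]
      push_cast
      calc (n : ℝ) * d ≤ n * (δ * ε * η / 2 ^ 5 * n) := by gcongr
        _ ≤ δ * s := by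
          rw [hs]
          have : 0 ≤ δ * ε * η * (n : ℝ) ^ 2 := by positivity
          nlinarith
  have hA : (256 * ρ) ^ ((n + m) * n) ≤ ((256 * ρ) ^ 2) ^ (n ^ 2) := by
    rw [← pow_mul]
    refine pow_le_pow_right₀ h256 ?_
    nlinarith
  have hB : (2 : ℝ) ^ m * 128 ^ (n * m) ≤ 256 ^ (n ^ 2) := by
    calc (2 : ℝ) ^ m * 128 ^ (n * m) ≤ 2 ^ (n ^ 2) * 128 ^ (n ^ 2) := by
          gcongr
          · norm_num
          · nlinarith
          · norm_num
          · nlinarith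
      _ = 256 ^ (n ^ 2) := by rw [← mul_pow]; norm_num
  have hcancel : a ^ (-(δ * s)) * a ^ (δ * s) = 1 := by
    rw [← Real.rpow_add ha]; simp
  calc (256 * ρ) ^ ((n + m) * n) * (18 / (a * ε)) ^ (n * d) * 2 ^ m *
        (b * a ^ δ) ^ (k * ((m + 1) / 2)) * 128 ^ (n * m)
      = (256 * ρ) ^ ((n + m) * n) * (18 / (a * ε)) ^ (n * d) *
        (2 ^ m * 128 ^ (n * m)) * (b * a ^ δ) ^ (k * ((m + 1) / 2)) := by ring
    _ ≤ ((256 * ρ) ^ 2) ^ (n ^ 2) * ((18 / ε) ^ (n ^ 2) * a ^ (-(δ * s))) * 256 ^ (n ^ 2) *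
        ((1 / (2 * M)) ^ (n ^ 2) * a ^ (δ * s)) := by gcongr
    _ = (M * (1 / (2 * M))) ^ (n ^ 2) * (a ^ (-(δ * s)) * a ^ (δ * s)) := by
        have hMp : M ^ (n ^ 2) = ((256 * ρ) ^ 2) ^ (n ^ 2) * (18 / ε) ^ (n ^ 2) * 256 ^ (n ^ 2) := by
          rw [hM, mul_pow, mul_pow]
        rw [mul_pow M, hMp]
        generalize ((256 * ρ) ^ 2) ^ (n ^ 2) = x₁
        generalize (18 / ε) ^ (n ^ 2) = x₂
        generalize (1 / (2 * M)) ^ (n ^ 2) = x₃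
        ring
    _ = (1 / 2) ^ (n ^ 2) := by
        rw [hcancel, mul_one]
        congr 1
        field_simp
    _ < 1 := pow_lt_one₀ (by norm_num) (by norm_num) (by positivity)

/-! ### Return to the abstract quotient -/

lemma quotientCoords_symm_apply {N : ℕ} {E : Type*} [NormedAddCommGroup E] [NormedSpace ℝ E]
    (e : E ≃ₗ[ℝ] EuclideanSpace ℝ (Fin N)) (K : Submodule ℝ E)
    (z : ↥((K.map (e : E →ₗ[ℝ] EuclideanSpace ℝ (Fin N)))ᗮ)) :
    (quotientCoords e K).symm z = K.mkQ (e.symm z) := by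
  rw [LinearEquiv.symm_apply_eq]
  have h1 : quotientCoords e K (K.mkQ (e.symm z)) =
      Submodule.quotientEquivOfIsCompl _ _ (Submodule.isCompl_orthogonal
        (K.map (e : E →ₗ[ℝ] EuclideanSpace ℝ (Fin N))))
        (Submodule.Quotient.mk (e (e.symm z))) := rfl
  rw [h1, e.apply_symm_apply, Submodule.quotientEquivOfIsCompl_apply_mk_right]

/-- A vector orthogonal to the kernel is the shortest in its coset, and the coset also contains the
first-block copy of `quotMap X z`. -/
lemma norm_le_norm_quotMap {n m : ℕ} (X : Fin m → EuclideanSpace ℝ (Fin n))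
    {z : EuclideanSpace ℝ (Fin (n + m))} (hz : z ∈ (quotMap X).kerᗮ) : ‖z‖ ≤ ‖quotMap X z‖ := by
  set w := headIncl n m (quotMap X z) with hw
  have h1 : w - z ∈ (quotMap X).ker := by
    rw [LinearMap.mem_ker, map_sub, hw, quotMap_headIncl, sub_self]
  have h2 : inner ℝ (w - z) z = 0 := (Submodule.mem_orthogonal _ _).1 hz _ h1
  have h3 : ‖z‖ * ‖z‖ ≤ ‖w‖ * ‖z‖ := by
    rw [← real_inner_self_eq_norm_mul_norm]
    rw [inner_sub_left, sub_eq_zero] at h2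
    rw [← h2]
    exact real_inner_le_norm _ _
  rw [← (headIncl n m).norm_map (quotMap X z)]
  by_contra hlt
  push Not at hlt
  nlinarith [norm_nonneg (headIncl n m (quotMap X z))]

lemma norm_starProjection_orthogonal_le {H : Type*} [NormedAddCommGroup H]
    [InnerProductSpace ℝ H] [FiniteDimensional ℝ H] (G : Submodule ℝ H) (w : H) {z : H}
    (hz : z ∈ G) : ‖Gᗮ.starProjection w‖ ≤ ‖w - z‖ := by
  have h1 : Gᗮ.starProjection w = Gᗮ.starProjection (w - z) := by
    rw [map_sub, Gᗮ.starProjection_apply_eq_zero_iff.2 (Submodule.le_orthogonal_orthogonal G hz),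
      sub_zero]
  rw [h1]
  simpa using Gᗮ.starProjection.le_of_opNorm_le Gᗮ.starProjection_norm_le (w - z)

/-- Mixing with respect to the natural Euclidean structure implies mixing with respect to the
Euclidean structure of the coordinates of the quotient. -/
lemma exists_mixing_submodule {n m : ℕ} {X : Fin m → EuclideanSpace ℝ (Fin n)}
    (hX : X ∈ opBall n m) {E : Type*} [NormedAddCommGroup E] [NormedSpace ℝ E]
    (e : E ≃ₗ[ℝ] EuclideanSpace ℝ (Fin (n + m))) (K : Submodule ℝ E)
    (hK : K.map (e : E →ₗ[ℝ] EuclideanSpace ℝ (Fin (n + m))) = (quotMap X).ker)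
    (q : (E ⧸ K) ≃ₗ[ℝ] EuclideanSpace ℝ (Fin n)) (hq : ∀ x, q (K.mkQ x) = quotMap X (e x))
    (T : (E ⧸ K) →ₗ[ℝ] (E ⧸ K)) {s : ℝ} (hT : IsMixing s 1 ((quotientCoords e K).conj T)) :
    ∃ G : Submodule ℝ (EuclideanSpace ℝ (Fin n)), s ≤ Module.finrank ℝ G ∧
      ∀ x ∈ G, ∀ g ∈ G, ‖x‖ ≤ 2 * ‖q.conj T x - g‖ := by
  obtain ⟨G₀, hG₀dim, hG₀⟩ := hT
  set qc := quotientCoords e K with hqc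
  have hqqc : ∀ z : ↥((K.map (e : E →ₗ[ℝ] EuclideanSpace ℝ (Fin (n + m))))ᗮ),
      q (qc.symm z) = quotMap X (z : EuclideanSpace ℝ (Fin (n + m))) := by
    intro z
    rw [hqc, quotientCoords_symm_apply, hq, e.apply_symm_apply]
  have hlow : ∀ z : ↥((K.map (e : E →ₗ[ℝ] EuclideanSpace ℝ (Fin (n + m))))ᗮ),
      ‖z‖ ≤ ‖q (qc.symm z)‖ := by
    intro z
    rw [hqqc, Submodule.coe_norm]
    refine norm_le_norm_quotMap X ?_
    rw [← hK]
    exact z.2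
  have hup : ∀ z : ↥((K.map (e : E →ₗ[ℝ] EuclideanSpace ℝ (Fin (n + m))))ᗮ),
      ‖q (qc.symm z)‖ ≤ 2 * ‖z‖ := by
    intro z
    rw [hqqc, Submodule.coe_norm]
    exact norm_quotMap_le hX _
  -- ψ compares the natural Euclidean norm of the quotient with that of ℝⁿ: it does not shrink and
  -- at most doubles norms, hence the mixing constant 2.
  let ψ : _ ≃ₗ[ℝ] EuclideanSpace ℝ (Fin n) := qc.symm.trans q
  refine ⟨G₀.map (ψ : _ →ₗ[ℝ] EuclideanSpace ℝ (Fin n)), ?_, ?_⟩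
  · rw [LinearEquiv.finrank_map_eq]
    exact hG₀dim
  · rintro _ ⟨z₁, hz₁, rfl⟩ _ ⟨z₂, hz₂, rfl⟩
    have h1 := hG₀ z₁ hz₁
    generalize hy : qc.conj T z₁ = y at h1
    have e1 : q.conj T (ψ z₁) = q (qc.symm y) := by
      rw [← hy, LinearEquiv.conj_apply_apply, LinearEquiv.conj_apply_apply,
        qc.symm_apply_apply]
      change q (T (q.symm (q (qc.symm z₁)))) = _
      rw [q.symm_apply_apply]
    have e2 : q.conj T (ψ z₁) - ψ z₂ = q (qc.symm (y - z₂)) := by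
      rw [e1, map_sub, map_sub]
      rfl
    change ‖q (qc.symm z₁)‖ ≤ 2 * ‖q.conj T (ψ z₁) - ψ z₂‖
    rw [e2]
    rw [one_mul] at h1
    have h2 := norm_starProjection_orthogonal_le G₀ y hz₂
    linarith [hup z₁, hlow (y - z₂)]

theorem mainTheorem5 :
    ∀ ε η κ ρ : ℝ, 0 < η → η < 3 / 8 → 0 < ε → ε < η / 2 ^ 5 → 0 < κ → κ ≤ 1 → 1 ≤ ρ →
    ∃ c : ℝ, 0 < c ∧
    ∀ δ : ℝ, 0 < δ → δ < 1 →
    ∀ n N : ℕ, 0 < n → (N : ℝ) = (1 + ε) * (n : ℝ) →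
    ∀ (E : Type) [NormedAddCommGroup E] [NormedSpace ℝ E]
      (e : E ≃ₗ[ℝ] EuclideanSpace ℝ (Fin N)) (a : ℝ), 0 < a → a ≤ 1 →
    coordBall e ⊆ Metric.closedBall 0 1 →
    volumeRatio (coordBall e) ≤ ρ →
    κ • l1Ball N ⊆ coordBall e →
    a • Metric.closedBall (0 : EuclideanSpace ℝ (Fin N)) 1 ⊆ coordBall e →
    ∃ K : Submodule ℝ E, Module.finrank ℝ (E ⧸ K) = n ∧
      ∀ T : (E ⧸ K) →L[ℝ] (E ⧸ K),
        IsMixing (η * (n : ℝ)) 1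
          ((quotientCoords e K).conj (T : (E ⧸ K) →ₗ[ℝ] (E ⧸ K))) →
        ∀ L : Submodule ℝ (E ⧸ K),
          (1 - δ * ε * η / 2 ^ 5) * (n : ℝ) ≤ (Module.finrank ℝ ((E ⧸ K) ⧸ L) : ℝ) →
          c * (volumeNumber ⌈η * (n : ℝ) / 4⌉₊ (coordBall e))⁻¹ * a ^ δ ≤ ‖L.mkQL ∘L T‖ := by
  intro ε η κ ρ hη hη38 hε hεη hκ hκ1 hρ
  have hε1 : ε ≤ 1 := by linarith
  have hη1 : η ≤ 1 := by linarith
  set b : ℝ := (1 / (2 * ((256 * ρ) ^ 2 * (18 / ε) * 256))) ^ (8 / (η * ε)) with hb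
  have hb0 : 0 < b := by rw [hb]; positivity
  -- This yields 12τV ≤ 3/4, which is the requirement 16τV ≤ 1 of the perturbation argument.
  have hb34 : b ≤ 3 / 4 := by
    have h18 : 1 ≤ 18 / ε := by rw [one_le_div hε]; linarith
    have h1 : 1 ≤ (256 * ρ) ^ 2 := one_le_pow₀ (by linarith)
    have hM1 : 1 ≤ (256 * ρ) ^ 2 * (18 / ε) * 256 := by
      calc (1 : ℝ) = 1 * 1 * 1 := by norm_num
        _ ≤ _ := by gcongr; norm_num
    have h2 : 1 / (2 * ((256 * ρ) ^ 2 * (18 / ε) * 256)) ≤ 1 / 2 := by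
      gcongr
      linarith
    have h3 : 1 ≤ 8 / (η * ε) := by
      rw [one_le_div (by positivity)]
      nlinarith
    calc b ≤ (1 / (2 * ((256 * ρ) ^ 2 * (18 / ε) * 256))) ^ (1 : ℝ) :=
          Real.rpow_le_rpow_of_exponent_ge (by positivity) (by linarith) h3
      _ ≤ 3 / 4 := by rw [Real.rpow_one]; linarith
  -- 12 = 4 · 3 combines the expansion constant 4 with the enlargement to 3τ; κ enters through τ =
  -- t/κ, so that 12τV = b a^δ.
  refine ⟨κ * b / 12, by positivity, ?_⟩
  intro δ hδ hδ1 n N hn hN E _ _ e a ha ha1 hB hvr hκB haB'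
  have hn0 : (0 : ℝ) < n := by exact_mod_cast hn
  have hnN : n < N := by
    have : (n : ℝ) < N := by rw [hN]; nlinarith
    exact_mod_cast this
  obtain ⟨m, rfl⟩ := Nat.exists_eq_add_of_le hnN.le
  have hm : 0 < m := by omega
  have hmε : (m : ℝ) = ε * n := by
    push_cast at hN; linarith
  have hmn : m ≤ n := by
    have : (m : ℝ) ≤ n := by rw [hmε]; nlinarith
    exact_mod_cast this
  set B := coordBall e with hBdef
  have : FiniteDimensional ℝ E := e.symm.finiteDimensional
  have hec : Continuous e :=
    (e : E →ₗ[ℝ] EuclideanSpace ℝ (Fin (n + m))).continuous_of_finiteDimensional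
  have : ProperSpace E := FiniteDimensional.proper_real E
  have hBc : IsCompact B := (isCompact_closedBall 0 1).image hec
  have hBconv : Convex ℝ B :=
    (convex_closedBall 0 1).linear_image (e : E →ₗ[ℝ] EuclideanSpace ℝ (Fin (n + m)))
  have hBsymm : ∀ z ∈ B, -z ∈ B := by
    rintro _ ⟨x, hx, rfl⟩
    refine ⟨-x, ?_, map_neg e x⟩
    rw [mem_closedBall_zero_iff] at *
    rwa [norm_neg]
  have haB : ∀ z, ‖z‖ ≤ a → z ∈ B := by
    intro z hz
    refine haB' ?_
    rw [smul_unitClosedBall_of_nonneg ha.le, mem_closedBall_zero_iff]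
    exact hz
  set k := ⌈η * (n : ℝ) / 4⌉₊ with hkdef
  have hk : 0 < k := Nat.ceil_pos.2 (by positivity)
  have hkn : k ≤ n := Nat.ceil_le.2 (by nlinarith)
  have hk1 : η * n / 4 ≤ k := Nat.le_ceil _
  have hk2 : (k : ℝ) < η * n / 4 + 1 := Nat.ceil_lt_add_one (by positivity)
  set V := volumeNumber k B with hVdef
  have hVa : a ≤ V := by
    obtain ⟨φ, -⟩ := exists_linearIsometry_mem (k := k)
      (⊤ : Submodule ℝ (EuclideanSpace ℝ (Fin (n + m)))) (by
        rw [finrank_top, finrank_euclideanSpace_fin]; omega)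
    refine le_volumeNumber hk hB φ ha.le fun u hu => ?_
    exact ⟨φ u, haB _ (by rwa [φ.norm_map]), adjoint_linearIsometry_apply φ u⟩
  have hV : 0 < V := ha.trans_le hVa
  set t := κ * b / 12 * V⁻¹ * a ^ δ with ht
  have haδ0 : 0 < a ^ δ := Real.rpow_pos_of_pos ha δ
  have haδ1 : a ^ δ ≤ 1 := Real.rpow_le_one ha.le ha1 hδ.le
  have ht0 : 0 < t := by positivity
  have hτ : 0 < t / κ := by positivity
  have hτV : 12 * (t / κ) * V = b * a ^ δ := by
    rw [ht]; field_simp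
  set d := ⌊δ * ε * η / 2 ^ 5 * n⌋₊ with hddef
  have hd : (d : ℝ) ≤ δ * ε * η / 2 ^ 5 * n := Nat.floor_le (by positivity)
  have hba : b * a ^ δ ≤ 3 / 4 :=
    (mul_le_of_le_one_right hb0.le haδ1).trans hb34
  obtain ⟨X, hX, hgood⟩ := exists_tuple_forall_mixing (d := d) hk hm hmn hBc hBconv hBsymm hB ha
    ha1 haB hρ hvr hτ hε hε1 hmε hV (by linarith) (by
      rw [hτV]
      exact union_bound_lt_one hη hη1 hε hε1 hρ ha ha1 hδ hδ1.le hb hn hmn hmε hk1 hd)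
  set Q : E →ₗ[ℝ] EuclideanSpace ℝ (Fin n) :=
    quotMap X ∘ₗ (e : E →ₗ[ℝ] EuclideanSpace ℝ (Fin (n + m))) with hQdef
  have hQ : Function.Surjective Q := by
    intro x
    refine ⟨e.symm (headIncl n m x), ?_⟩
    change quotMap X (e (e.symm _)) = x
    rw [e.apply_symm_apply, quotMap_headIncl]
  let q : (E ⧸ Q.ker) ≃ₗ[ℝ] EuclideanSpace ℝ (Fin n) := Q.quotKerEquivOfSurjective hQ
  have hq : ∀ x, q (Q.ker.mkQ x) = quotMap X (e x) := fun x => rfl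
  have hfin : Module.finrank ℝ (E ⧸ Q.ker) = n := by
    rw [q.finrank_eq, finrank_euclideanSpace_fin]
  refine ⟨Q.ker, hfin, ?_⟩
  intro T hT L hL
  by_contra hlt
  push Not at hlt
  change _ < t at hlt
  have hker : (Q.ker.map (e : E →ₗ[ℝ] EuclideanSpace ℝ (Fin (n + m)))) = (quotMap X).ker := by
    ext z
    constructor
    · rintro ⟨x, hx, rfl⟩; exact hx
    · intro hz
      refine ⟨e.symm z, ?_, e.apply_symm_apply z⟩
      change quotMap X (e (e.symm z)) = 0
      rw [e.apply_symm_apply]; exact hz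
  obtain ⟨G, hGdim, hG⟩ := exists_mixing_submodule hX e Q.ker hker q hq
    (T : (E ⧸ Q.ker) →ₗ[ℝ] (E ⧸ Q.ker)) hT
  set TH : EuclideanSpace ℝ (Fin n) →ₗ[ℝ] EuclideanSpace ℝ (Fin n) :=
    q.conj (T : (E ⧸ Q.ker) →ₗ[ℝ] (E ⧸ Q.ker)) with hTH
  have hTHq : ∀ f, TH (q f) = q (T f) := by
    intro f
    rw [hTH, LinearEquiv.conj_apply_apply, q.symm_apply_apply]; rfl
  refine hgood TH (L.map (q : (E ⧸ Q.ker) →ₗ[ℝ] EuclideanSpace ℝ (Fin n)))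
    G ?_ ?_ hG ?_
  · rw [LinearEquiv.finrank_map_eq]
    refine Nat.le_floor ?_
    have h1 := Submodule.finrank_quotient_add_finrank L
    rw [hfin] at h1
    have h2 : (Module.finrank ℝ ((E ⧸ Q.ker) ⧸ L) : ℝ) + Module.finrank ℝ L = n := by
      exact_mod_cast h1
    linarith
  -- Here 2k ≤ ηn/2 + 2, the rounding 2 is at most 2m, and 32m ≤ ηn with d ≤ m/32 make the total at
  -- most ηn.
  · have hm1 : (1 : ℝ) ≤ m := by exact_mod_cast hm
    have h32 : 32 * (m : ℝ) ≤ η * n := by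
      rw [hmε]
      have : ε * n ≤ η / 2 ^ 5 * n := by gcongr
      linarith
    have hdm : (d : ℝ) ≤ m / 32 := by
      refine hd.trans ?_
      rw [hmε]
      have h1 : δ * η ≤ 1 := mul_le_one₀ hδ1.le hη.le hη1
      have h2 : 0 ≤ ε * n := by positivity
      nlinarith
    have h3 : ((2 * k + 2 * m + 2 * d : ℕ) : ℝ) ≤ Module.finrank ℝ G := by
      push_cast
      linarith
    exact_mod_cast h3
  · intro i
    have hi : κ • EuclideanSpace.single i (1 : ℝ) ∈ B := by
      refine hκB (Set.smul_mem_smul_set ?_)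
      change ∑ l, |EuclideanSpace.single i (1 : ℝ) l| ≤ 1
      rw [Finset.sum_eq_single i] <;> simp +contextual
    obtain ⟨x, hx, hxi⟩ := hi
    rw [mem_closedBall_zero_iff] at hx
    set f := Q.ker.mkQ x with hf
    have hf1 : ‖f‖ ≤ 1 := (Submodule.Quotient.norm_mk_le Q.ker x).trans hx
    have h1 : ‖(L.mkQL ∘L T) f‖ < t := by
      refine lt_of_le_of_lt ?_ hlt
      exact ((L.mkQL ∘L T).le_opNorm f).trans (mul_le_of_le_one_right (norm_nonneg _) hf1)
    -- The strict inequality permits lifting twice, through L and then through the kernel of Q, to a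
    -- vector x' of norm below t; the difference made by the first lift lies in L.
    obtain ⟨f', hf', hf't⟩ := QuotientAddGroup.norm_lt_iff.1 h1
    obtain ⟨x', hx', hx't⟩ := QuotientAddGroup.norm_lt_iff.1 hf't
    have hmem : T f - f' ∈ L := by
      rw [← Submodule.Quotient.mk_eq_zero, Submodule.Quotient.mk_sub, sub_eq_zero]
      exact hf'.symm
    refine ⟨e (t⁻¹ • x'), ⟨t⁻¹ • x', ?_, rfl⟩, ?_⟩
    · rw [mem_closedBall_zero_iff, norm_smul, norm_inv, Real.norm_of_nonneg ht0.le,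
        inv_mul_le_iff₀ ht0, mul_one]
      exact hx't.le
    · have e1 : quotMap X (EuclideanSpace.single i 1) = κ⁻¹ • q f := by
        rw [hf, hq]
        have hxi' : e x = κ • EuclideanSpace.single i (1 : ℝ) := hxi
        rw [hxi', map_smul, inv_smul_smul₀ hκ.ne']
      have e2 : (t / κ) • quotMap X (e (t⁻¹ • x')) = κ⁻¹ • q f' := by
        have : q f' = quotMap X (e x') := by rw [← hx']; exact hq x'
        rw [this, map_smul, map_smul, smul_smul]
        congr 1
        field_simp
      rw [e1, e2, map_smul, hTHq, ← smul_sub, ← map_sub]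
      exact Submodule.smul_mem _ _ ⟨_, hmem, rfl⟩
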